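/- Let $M$ be a (Hausdorff) $C^\infty$ manifold of dimension $n$ and let $F:TM\to\mathbb R$ be a Finsler metric on $M$: $F$ is $C^\infty$ off the zero section, $F(x,X)>0$ for $X\neq 0_x$, $F(x,rX)=rF(x,X)$ for $r\ge 0$, and $g_{ij}=\frac12\,\partial^2F^2/\partial X^i\partial X^j$ is positive definite at every $X\ne 0_x$. The length of a piecewise $C^1$ curve $\gamma:[a,b]\to M$ is $L(\gamma)=\int_a^bF(\gamma(t),\dot\gamma(t))\,dt$. A geodesic is a $C^2$ curve $c:[a,b]\to M$, $a<b$, that satisfies the Euler–Lagrange equations $\frac{d}{dt}\frac{\partial F^2}{\partial X^i}(c,\dot c)=\frac{\partial F^2}{\partial x^i}(c,\dot c)$ in every chart (so it is affinely parametrized; constant curves are allowed). Put $Exp_y(X)=c(1)$, where $c:[0,1]\to M$ is the geodesic with $c(0)=y$ and $\dot c(0)=X$, whenever it exists; $B_\rho(0_y)=\{X\in T_yM: F(y,X)<\rho\}$; and $B_\rho(y)=Exp_y(B_\rho(0_y))$. Let $x\in M$ and let $0<\varepsilon<\eta$ be real numbers such that: (i) $Exp_x$ is defined on $B_\varepsilon(0_x)$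 and is a diffeomorphism from $B_\varepsilon(0_x)$ onto $B_\varepsilon(x)$, of class $C^1$ on $B_\varepsilon(0_x)$ and of class $C^\infty$ on $B_\varepsilon(0_x)\setminus\{0_x\}$, and $B_\varepsilon(x)$ is an open neighbourhood of $x$; (ii) for all $y,z\in B_\varepsilon(x)$ there is a unique geodesic $c:[0,1]\to M$ lying entirely in $B_\eta(y)$ and having length less than $\eta$ such that $c(0)=y$ and $c(1)=z$; (iii) for every $y\in B_\varepsilon(x)$, $Exp_y$ is defined on $B_\eta(0_y)$ and is a diffeomorphism from $B_\eta(0_y)$ onto $B_\eta(y)$, of class $C^1$ on $B_\eta(0_y)$ and of class $C^\infty$ on $B_\eta(0_y)\setminus\{0_y\}$, and $B_\eta(y)$ is an open neighbourhood of $y$ containing $B_\varepsilon(x)$. Then every geodesic $c:[a,b]\to M$ with $c(a)\in B_\varepsilon(x)$ and $L(c)<\eta$ is a curve of minimal length between its end points: $L(c)\le L(\gamma)$ for every piecewise $C^1$ curve $\gamma:[a',b']\to M$ with $\gamma(a')=c(a)$ and $\gamma(b')=c(b)$. -/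

import Mathlib

open Set
open scoped Manifold ContDiff

noncomputable section

namespace Finsler

/-- The tensor `g_{(x,X)}(Y,Z) = (1/2) * (∂²/∂s∂t) F²(x, X + sY + tZ)` at `s = t = 0`; in the
coordinates induced on `TM` its components are `(1/2) ∂²F²/∂Xⁱ∂Xʲ`. -/
def fundamentalTensor {n : ℕ} {M : Type*} [TopologicalSpace M]
    [ChartedSpace (EuclideanSpace ℝ (Fin n)) M]
    (F : TangentBundle (𝓡 n) M → ℝ) (x : M) (X Y Z : TangentSpace (𝓡 n) x) : ℝ :=
  (1 / 2) * deriv (fun s : ℝ => deriv (fun t : ℝ => F ⟨x, X + s • Y + t • Z⟩ ^ 2) 0) 0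

/-- A Finsler metric function on an `n`-dimensional smooth manifold: positive, smooth off the zero
section, positively homogeneous of degree one on the fibres, with positive definite fundamental
tensor. Reversibility `F(x,-X) = F(x,X)` is not required. -/
structure FinslerMetric (n : ℕ) (M : Type*) [TopologicalSpace M]
    [ChartedSpace (EuclideanSpace ℝ (Fin n)) M] [IsManifold (𝓡 n) ∞ M] where
  /-- the metric function `F : TM → ℝ` -/
  toFun : TangentBundle (𝓡 n) M → ℝ
  pos : ∀ (x : M) (X : TangentSpace (𝓡 n) x), X ≠ 0 → 0 < toFun ⟨x, X⟩
  homogeneous : ∀ (x : M) (X : TangentSpace (𝓡 n) x) (r : ℝ), 0 ≤ r →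
    toFun ⟨x, r • X⟩ = r * toFun ⟨x, X⟩
  smooth : ContMDiffOn (𝓡 n).tangent 𝓘(ℝ, ℝ) ∞ toFun {v | v.2 ≠ 0}
  convex : ∀ (x : M) (X Y : TangentSpace (𝓡 n) x), X ≠ 0 → Y ≠ 0 →
    0 < fundamentalTensor toFun x X Y Y

/-- The velocity `(c(t), c'(t)) ∈ TM` of a curve `c : [a,b] → M` (one-sided at `a` and `b`). -/
def velocity (n : ℕ) {M : Type*} [TopologicalSpace M]
    [ChartedSpace (EuclideanSpace ℝ (Fin n)) M] (c : ℝ → M) (a b t : ℝ) :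
    TangentBundle (𝓡 n) M :=
  ⟨c t, mfderivWithin 𝓘(ℝ, ℝ) (𝓡 n) c (Icc a b) t (1 : ℝ)⟩

/-- `c : [a,b] → M` is continuous and piecewise `C¹`: there are `a = p 0 ≤ p 1 ≤ … ≤ p k = b` such
that `c` is `C¹` on each closed interval `[p i, p (i+1)]`. -/
def IsPiecewiseC1 (n : ℕ) {M : Type*} [TopologicalSpace M]
    [ChartedSpace (EuclideanSpace ℝ (Fin n)) M] (c : ℝ → M) (a b : ℝ) : Prop :=
  ∃ (k : ℕ) (p : ℕ → ℝ), Monotone p ∧ p 0 = a ∧ p k = b ∧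
    ∀ i < k, ContMDiffOn 𝓘(ℝ, ℝ) (𝓡 n) 1 c (Icc (p i) (p (i + 1)))

namespace FinslerMetric

/-- The Finslerian length `∫ₐᵇ F(c(t), c'(t)) dt` of a piecewise `C¹` curve `c : [a,b] → M`. -/
def length {n : ℕ} {M : Type*} [TopologicalSpace M]
    [ChartedSpace (EuclideanSpace ℝ (Fin n)) M] [IsManifold (𝓡 n) ∞ M]
    (F : FinslerMetric n M) (c : ℝ → M) (a b : ℝ) : ℝ :=
  ∫ t in a..b, F.toFun (velocity n c a b t)

/-- The expression of `F²` in the coordinates `(x¹,…,xⁿ,X¹,…,Xⁿ)` induced on `TM` by a chart `φ`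
of `M`. -/
def sqInChart {n : ℕ} {M : Type*} [TopologicalSpace M]
    [ChartedSpace (EuclideanSpace ℝ (Fin n)) M] [IsManifold (𝓡 n) ∞ M]
    (F : FinslerMetric n M) (φ : OpenPartialHomeomorph M (EuclideanSpace ℝ (Fin n)))
    (u w : EuclideanSpace ℝ (Fin n)) : ℝ :=
  F.toFun ⟨φ.symm u, mfderiv (𝓡 n) (𝓡 n) φ.symm u w⟩ ^ 2

/-- `c : [a,b] → M` is a (constant speed) geodesic of `F`: it is of class `C²` and solves, in every
chart `φ` of the smooth structure, the Euler-Lagrange equations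
`d/dt (∂F²/∂Xⁱ (c, c')) = ∂F²/∂xⁱ (c, c')`, here tested against all constant directions `e`.
Constant curves are geodesics. -/
def IsGeodesic {n : ℕ} {M : Type*} [TopologicalSpace M]
    [ChartedSpace (EuclideanSpace ℝ (Fin n)) M] [IsManifold (𝓡 n) ∞ M]
    (F : FinslerMetric n M) (c : ℝ → M) (a b : ℝ) : Prop :=
  ContMDiffOn 𝓘(ℝ, ℝ) (𝓡 n) 2 c (Icc a b) ∧
  ∀ φ ∈ IsManifold.maximalAtlas (𝓡 n) ∞ M, ∀ t ∈ Icc a b, c t ∈ φ.source →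
    ∀ e : EuclideanSpace ℝ (Fin n),
      HasDerivWithinAt
        (fun s : ℝ => fderiv ℝ (fun w => F.sqInChart φ (φ (c s)) w)
          (derivWithin (fun r => φ (c r)) (Icc a b) s) e)
        (fderiv ℝ (fun u => F.sqInChart φ u (derivWithin (fun r => φ (c r)) (Icc a b) t))
          (φ (c t)) e)
        (Icc a b) t

/-- `v ∈ TM` is the initial velocity of a geodesic `c : [0,1] → M` with `c(1) = z`. -/
def ExpRel {n : ℕ} {M : Type*} [TopologicalSpace M]
    [ChartedSpace (EuclideanSpace ℝ (Fin n)) M] [IsManifold (𝓡 n) ∞ M]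
    (F : FinslerMetric n M) (v : TangentBundle (𝓡 n) M) (z : M) : Prop :=
  ∃ c : ℝ → M, F.IsGeodesic c 0 1 ∧ velocity n c 0 1 0 = v ∧ c 1 = z

/-- The set of the `v ∈ TM` at which the exponential mapping is defined. -/
def expDomain {n : ℕ} {M : Type*} [TopologicalSpace M]
    [ChartedSpace (EuclideanSpace ℝ (Fin n)) M] [IsManifold (𝓡 n) ∞ M]
    (F : FinslerMetric n M) : Set (TangentBundle (𝓡 n) M) :=
  {v | ∃ z, F.ExpRel v z}

open Classical in
/-- The exponential mapping of `F`: `exp v = c_v(1)`, where `c_v` is the geodesic with initial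
velocity `v` (unique on a Hausdorff manifold). Outside `expDomain` the value is irrelevant. -/
def exp {n : ℕ} {M : Type*} [TopologicalSpace M]
    [ChartedSpace (EuclideanSpace ℝ (Fin n)) M] [IsManifold (𝓡 n) ∞ M]
    (F : FinslerMetric n M) (v : TangentBundle (𝓡 n) M) : M :=
  if h : ∃ z, F.ExpRel v z then h.choose else v.1

/-- `Exp_x : T_xM → M`; the tangent space is identified with its model space `ℝⁿ`. -/
def expAt {n : ℕ} {M : Type*} [TopologicalSpace M]
    [ChartedSpace (EuclideanSpace ℝ (Fin n)) M] [IsManifold (𝓡 n) ∞ M]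
    (F : FinslerMetric n M) (x : M) (X : EuclideanSpace ℝ (Fin n)) : M :=
  F.exp ⟨x, X⟩

/-- The open indicatrix `B_ρ(0_x) = {X ∈ T_xM | F(x,X) < ρ}`. -/
def tangentBall {n : ℕ} {M : Type*} [TopologicalSpace M]
    [ChartedSpace (EuclideanSpace ℝ (Fin n)) M] [IsManifold (𝓡 n) ∞ M]
    (F : FinslerMetric n M) (x : M) (ρ : ℝ) : Set (EuclideanSpace ℝ (Fin n)) :=
  {X | F.toFun ⟨x, X⟩ < ρ}

/-- `B_ρ(x) = Exp_x(B_ρ(0_x))`. -/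
def expBall {n : ℕ} {M : Type*} [TopologicalSpace M]
    [ChartedSpace (EuclideanSpace ℝ (Fin n)) M] [IsManifold (𝓡 n) ∞ M]
    (F : FinslerMetric n M) (x : M) (ρ : ℝ) : Set M :=
  F.expAt x '' F.tangentBall x ρ

/-- `Exp_x` is defined on `B_ρ(0_x)` and is a diffeomorphism from `B_ρ(0_x)` onto the open
neighbourhood `B_ρ(x)` of `x`, of class `C¹` on `B_ρ(0_x)` and of class `C^∞` on
`B_ρ(0_x) - {0_x}`. -/
structure IsExpDiffeo {n : ℕ} {M : Type*} [TopologicalSpace M]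
    [ChartedSpace (EuclideanSpace ℝ (Fin n)) M] [IsManifold (𝓡 n) ∞ M]
    (F : FinslerMetric n M) (x : M) (ρ : ℝ) : Prop where
  defined : ∀ X ∈ F.tangentBall x ρ, (⟨x, X⟩ : TangentBundle (𝓡 n) M) ∈ F.expDomain
  isOpen_expBall : IsOpen (F.expBall x ρ)
  mem_expBall : x ∈ F.expBall x ρ
  contMDiffOn_one : ContMDiffOn (𝓡 n) (𝓡 n) 1 (F.expAt x) (F.tangentBall x ρ)
  contMDiffOn_infty : ContMDiffOn (𝓡 n) (𝓡 n) ∞ (F.expAt x) (F.tangentBall x ρ \ {0})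
  exists_inverse : ∃ L : M → EuclideanSpace ℝ (Fin n),
    LeftInvOn L (F.expAt x) (F.tangentBall x ρ) ∧
    ContMDiffOn (𝓡 n) (𝓡 n) 1 L (F.expBall x ρ) ∧
    ContMDiffOn (𝓡 n) (𝓡 n) ∞ L (F.expAt x '' (F.tangentBall x ρ \ {0}))

/-- The requirements on the two radii `ε = ε(x) < η = η(x)` at a point `x`. -/
structure AreConvexRadii {n : ℕ} {M : Type*} [TopologicalSpace M]
    [ChartedSpace (EuclideanSpace ℝ (Fin n)) M] [IsManifold (𝓡 n) ∞ M]
    (F : FinslerMetric n M) (x : M) (ε η : ℝ) : Prop where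
  pos : 0 < ε
  lt : ε < η
  /-- `Exp_x : B_ε(0_x) → B_ε(x)` is a diffeomorphism onto an open neighbourhood of `x` -/
  diffeo : F.IsExpDiffeo x ε
  /-- any `y, z ∈ B_ε(x)` are joined by a unique geodesic `c : [0,1] → M` of length less than `η`
  lying in `B_η(y)` -/
  existsUnique_geodesic : ∀ y ∈ F.expBall x ε, ∀ z ∈ F.expBall x ε,
    ∃ c : ℝ → M,
      (F.IsGeodesic c 0 1 ∧ MapsTo c (Icc 0 1) (F.expBall y η) ∧ F.length c 0 1 < η ∧
        c 0 = y ∧ c 1 = z) ∧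
      ∀ c' : ℝ → M,
        (F.IsGeodesic c' 0 1 ∧ MapsTo c' (Icc 0 1) (F.expBall y η) ∧ F.length c' 0 1 < η ∧
          c' 0 = y ∧ c' 1 = z) → EqOn c' c (Icc 0 1)
  /-- `Exp_y : B_η(0_y) → B_η(y)` is a diffeomorphism onto an open neighbourhood of `y` that
  contains `B_ε(x)`, for all `y ∈ B_ε(x)` -/
  diffeo_nearby : ∀ y ∈ F.expBall x ε, F.IsExpDiffeo y η ∧ F.expBall x ε ⊆ F.expBall y η

/-- `c : [a,b] → M` is a curve of minimal length among the piecewise `C¹` curves, on any closed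
interval, from `c(a)` to `c(b)`. -/
def IsLengthMinimizing {n : ℕ} {M : Type*} [TopologicalSpace M]
    [ChartedSpace (EuclideanSpace ℝ (Fin n)) M] [IsManifold (𝓡 n) ∞ M]
    (F : FinslerMetric n M) (c : ℝ → M) (a b : ℝ) : Prop :=
  ∀ (γ : ℝ → M) (a' b' : ℝ), IsPiecewiseC1 n γ a' b' → γ a' = c a → γ b' = c b →
    F.length c a b ≤ F.length γ a' b'

end FinslerMetric

end Finsler

end

/-! Put y = c(a) and r = L(c) < η, and let ρ(Exp_y X) = F(y,X) be the radial function of the normal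
ball B_η(y). A geodesic has constant speed, so c(b) = Exp_y(X) with F(y,X) = r, and the point is
that ρ grows along a curve by at most its length, i.e. dρ(w) ≤ F(w) away from y. Two facts give
this. The Gauss lemma (`fderiv_eq_of_rays`) identifies dρ with the fibre derivative of F at the
radial vector. The fundamental inequality (`fderiv_fiber_le`), a consequence of the convexity of F²
on the fibres, bounds that derivative by F.

A competing curve may leave the ball, or pass through y, where ρ need not be differentiable. So ρ is
replaced by R = min(ρ, r), extended by r outside the ball. R is continuous on M because {ρ ≤ r} is
compact, hence closed in the Hausdorff space M, and only its values strictly between 0 and r require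
a derivative estimate (`sub_le_integral_of_hasDerivAt_of_mem_Ioo`). Along every competitor R climbs
from 0 to r.

F² need not be C² on the zero section, nor Exp_y at 0. Hence zero velocities are treated separately,
Exp_y⁻¹ serves as a chart of the punctured ball only, and the C¹ regularity of Exp_y at 0 enters the
Gauss lemma as a bound near the centre. That rays are mapped to geodesics rests on uniqueness for
given initial velocity (`IsGeodesic.eqOn_of_velocity_eq`), where the fibre Hessian is inverted. -/

namespace Finsler

open Filter Topology

/-! ### Minkowski norms: Euler's relation and the fundamental inequality. -/

/-- A smooth family `f u`, `u ∈ U`, of Minkowski norms on a normed space: the coordinate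
expression of a Finsler metric. -/
structure IsLocalFinsler {E : Type*} [NormedAddCommGroup E] [NormedSpace ℝ E]
    (f : E → E → ℝ) (U : Set E) : Prop where
  isOpen : IsOpen U
  contDiffOn : ContDiffOn ℝ ∞ (fun p : E × E => f p.1 p.2) (U ×ˢ {0}ᶜ)
  pos : ∀ u ∈ U, ∀ w : E, w ≠ 0 → 0 < f u w
  homog : ∀ u ∈ U, ∀ (w : E) (r : ℝ), 0 ≤ r → f u (r • w) = r * f u w
  hess_pos : ∀ u ∈ U, ∀ v Y : E, v ≠ 0 → Y ≠ 0 →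
    0 < deriv (deriv (fun t : ℝ => f u (v + t • Y) ^ 2)) 0

namespace IsLocalFinsler

variable {E : Type*} [NormedAddCommGroup E] [NormedSpace ℝ E] {f : E → E → ℝ} {U : Set E}

theorem map_zero (hf : IsLocalFinsler f U) {u : E} (hu : u ∈ U) : f u 0 = 0 := by
  simpa using hf.homog u hu 0 0 le_rfl

theorem nonneg (hf : IsLocalFinsler f U) {u : E} (hu : u ∈ U) (w : E) : 0 ≤ f u w := by
  by_cases hw : w = 0
  · rw [hw, hf.map_zero hu]
  · exact (hf.pos u hu w hw).le

theorem isOpen_prod (hf : IsLocalFinsler f U) : IsOpen (U ×ˢ ({0}ᶜ : Set E)) :=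
  hf.isOpen.prod isOpen_compl_singleton

theorem contDiffAt (hf : IsLocalFinsler f U) {u w : E} (hu : u ∈ U) (hw : w ≠ 0) :
    ContDiffAt ℝ ∞ (fun p : E × E => f p.1 p.2) (u, w) :=
  hf.contDiffOn.contDiffAt (hf.isOpen_prod.mem_nhds ⟨hu, hw⟩)

theorem contDiffAt_sq (hf : IsLocalFinsler f U) {u w : E} (hu : u ∈ U) (hw : w ≠ 0) :
    ContDiffAt ℝ ∞ (fun p : E × E => f p.1 p.2 ^ 2) (u, w) :=
  (hf.contDiffAt hu hw).pow 2

theorem contDiffAt_fiber (hf : IsLocalFinsler f U) {u w : E} (hu : u ∈ U) (hw : w ≠ 0) :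
    ContDiffAt ℝ ∞ (f u) w :=
  (hf.contDiffAt hu hw).comp w (contDiffAt_const.prodMk contDiffAt_id)

theorem differentiableAt_fiber (hf : IsLocalFinsler f U) {u w : E} (hu : u ∈ U) (hw : w ≠ 0) :
    DifferentiableAt ℝ (f u) w :=
  (hf.contDiffAt_fiber hu hw).differentiableAt (by simp)

theorem differentiableAt_sq (hf : IsLocalFinsler f U) {u w : E} (hu : u ∈ U) (hw : w ≠ 0) :
    DifferentiableAt ℝ (fun p : E × E => f p.1 p.2 ^ 2) (u, w) :=
  (hf.contDiffAt_sq hu hw).differentiableAt (by simp)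

theorem fderiv_fiber_sq_apply (hf : IsLocalFinsler f U) {u w : E} (hu : u ∈ U) (hw : w ≠ 0)
    (e : E) : fderiv ℝ (fun w => f u w ^ 2) w e =
      fderiv ℝ (fun p : E × E => f p.1 p.2 ^ 2) (u, w) (0, e) := by
  have h := (hf.differentiableAt_sq hu hw).hasFDerivAt.comp w
    ((hasFDerivAt_const u w).prodMk (hasFDerivAt_id w))
  have h' : HasFDerivAt (fun w => f u w ^ 2) _ w := h
  rw [h'.fderiv]
  simp

theorem fderiv_base_sq_apply (hf : IsLocalFinsler f U) {u w : E} (hu : u ∈ U) (hw : w ≠ 0)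
    (e : E) : fderiv ℝ (fun u => f u w ^ 2) u e =
      fderiv ℝ (fun p : E × E => f p.1 p.2 ^ 2) (u, w) (e, 0) := by
  have h := (hf.differentiableAt_sq hu hw).hasFDerivAt.comp (f := fun u => (u, w)) u
    ((hasFDerivAt_id u).prodMk (hasFDerivAt_const w u))
  have h' : HasFDerivAt (fun u => f u w ^ 2) _ u := h
  rw [h'.fderiv]
  simp

theorem fderiv_fiber_sq (hf : IsLocalFinsler f U) {u w : E} (hu : u ∈ U) (hw : w ≠ 0)
    (e : E) : fderiv ℝ (fun w => f u w ^ 2) w e = 2 * f u w * fderiv ℝ (f u) w e := by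
  have h := (hf.differentiableAt_fiber hu hw).hasFDerivAt.pow 2
  have h' : HasFDerivAt (fun w => f u w ^ 2) _ w := h
  rw [h'.fderiv]
  simp

/-- Euler's relation for `f u`. -/
theorem fderiv_fiber_self (hf : IsLocalFinsler f U) {u w : E} (hu : u ∈ U) (hw : w ≠ 0) :
    fderiv ℝ (f u) w w = f u w := by
  have h1 : HasDerivAt (fun r : ℝ => r • w) w 1 := by
    simpa using (hasDerivAt_id (1 : ℝ)).smul_const w
  have h2 : HasFDerivAt (f u) (fderiv ℝ (f u) w) ((1 : ℝ) • w) := by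
    rw [one_smul]; exact (hf.differentiableAt_fiber hu hw).hasFDerivAt
  have h3 := h2.comp_hasDerivAt 1 h1
  have h4 : HasDerivAt (fun r : ℝ => r * f u w) (f u w) 1 := by
    simpa using (hasDerivAt_id (1 : ℝ)).mul_const (f u w)
  refine h3.unique (h4.congr_of_eventuallyEq ?_)
  filter_upwards [Ioi_mem_nhds (zero_lt_one' ℝ)] with r hr
  exact hf.homog u hu w r (le_of_lt hr)

theorem fderiv_sq_self (hf : IsLocalFinsler f U) {u w : E} (hu : u ∈ U) (hw : w ≠ 0) :
    fderiv ℝ (fun p : E × E => f p.1 p.2 ^ 2) (u, w) (0, w) = 2 * f u w ^ 2 := by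
  rw [← hf.fderiv_fiber_sq_apply hu hw, hf.fderiv_fiber_sq hu hw, hf.fderiv_fiber_self hu hw]
  ring

theorem contDiffAt_line (hf : IsLocalFinsler f U) {u v Y : E} (hu : u ∈ U) {t : ℝ}
    (h : v + t • Y ≠ 0) : ContDiffAt ℝ ∞ (fun t : ℝ => f u (v + t • Y) ^ 2) t := by
  have h1 : ContDiffAt ℝ ∞ (fun t : ℝ => v + t • Y) t := by fun_prop
  exact ((hf.contDiffAt_fiber hu h).comp t h1).pow 2

theorem deriv_line (hf : IsLocalFinsler f U) {u v Y : E} (hu : u ∈ U) {t : ℝ}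
    (h : v + t • Y ≠ 0) : deriv (fun t : ℝ => f u (v + t • Y) ^ 2) t =
      fderiv ℝ (fun w => f u w ^ 2) (v + t • Y) Y := by
  have h1 : HasDerivAt (fun t : ℝ => v + t • Y) Y t := by
    simpa using (((hasDerivAt_id t).smul_const Y).const_add v :)
  have h2 : DifferentiableAt ℝ (fun w => f u w ^ 2) (v + t • Y) :=
    (hf.differentiableAt_fiber hu h).pow 2
  exact (h2.hasFDerivAt.comp_hasDerivAt t h1).deriv

theorem deriv_deriv_line_pos (hf : IsLocalFinsler f U) {u v Y : E} (hu : u ∈ U) {t : ℝ}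
    (h : v + t • Y ≠ 0) (hY : Y ≠ 0) :
    0 < deriv (deriv (fun t : ℝ => f u (v + t • Y) ^ 2)) t := by
  have := hf.hess_pos u hu (v + t • Y) Y h hY
  have h2 : (fun s : ℝ => f u (v + t • Y + s • Y) ^ 2) =
      fun s : ℝ => (fun t : ℝ => f u (v + t • Y) ^ 2) (t + s) := by
    funext s; simp only [add_smul, add_assoc]
  rw [h2] at this
  have h3 : deriv (fun s : ℝ => (fun t : ℝ => f u (v + t • Y) ^ 2) (t + s)) =
      fun s => deriv (fun t : ℝ => f u (v + t • Y) ^ 2) (t + s) := by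
    funext s
    exact deriv_comp_const_add (fun t : ℝ => f u (v + t • Y) ^ 2) t s
  rw [h3, deriv_comp_const_add] at this
  simpa using this

/-- Strict convexity along a segment avoiding the origin, in first-order form. -/
theorem fderiv_fiber_sq_sub_le (hf : IsLocalFinsler f U) {u v w : E} (hu : u ∈ U)
    (h : ∀ t ∈ Icc (0 : ℝ) 1, v + t • (w - v) ≠ 0) :
    f u v ^ 2 + fderiv ℝ (fun w => f u w ^ 2) v (w - v) ≤ f u w ^ 2 := by
  by_cases hY : w - v = 0
  · rw [hY, sub_eq_zero.1 hY]; simp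
  set q : ℝ → ℝ := fun t => f u (v + t • (w - v)) ^ 2 with hq
  have hsm : ∀ t ∈ Icc (0 : ℝ) 1, ContDiffAt ℝ ∞ q t := fun t ht => hf.contDiffAt_line hu (h t ht)
  have hd : ∀ t ∈ Icc (0 : ℝ) 1, DifferentiableAt ℝ q t := fun t ht =>
    (hsm t ht).differentiableAt (by simp)
  have hmono : StrictMonoOn (deriv q) (Icc 0 1) := by
    refine strictMonoOn_of_deriv_pos (convex_Icc 0 1) ?_ ?_
    · intro t ht
      have h1 : ContDiffAt ℝ 1 (deriv q) t := (hsm t ht).derivWithin (m := 1) (by norm_cast)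
      exact h1.continuousAt.continuousWithinAt
    · intro t ht
      exact hf.deriv_deriv_line_pos hu (h t (interior_subset ht)) hY
  -- By the mean value theorem q(1) - q(0) = q'(ξ), which exceeds q'(0) since q' is increasing.
  obtain ⟨ξ, hξ, hξ'⟩ := exists_deriv_eq_slope q zero_lt_one
    (fun t ht => (hd t ht).continuousAt.continuousWithinAt)
    (fun t ht => (hd t (Ioo_subset_Icc_self ht)).differentiableWithinAt)
  have h0 := hmono (left_mem_Icc.2 zero_le_one) (Ioo_subset_Icc_self hξ) hξ.1
  have h1 : deriv q 0 = fderiv ℝ (fun w => f u w ^ 2) v (w - v) := by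
    have := hf.deriv_line hu (h 0 (left_mem_Icc.2 zero_le_one))
    simpa using this
  have hq0 : q 0 = f u v ^ 2 := by simp [hq]
  have hq1 : q 1 = f u w ^ 2 := by simp [hq]
  rw [hξ', hq0, hq1, h1] at h0
  linarith

/-- The fundamental inequality for Minkowski norms. -/
theorem fderiv_fiber_le (hf : IsLocalFinsler f U) {u v : E} (hu : u ∈ U) (hv : v ≠ 0) (w : E) :
    fderiv ℝ (f u) v w ≤ f u w := by
  have hfv := hf.pos u hu v hv
  by_cases hw : w = 0
  · simp [hw, hf.map_zero hu]
  have hfw := hf.pos u hu w hw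
  -- If w points opposite to v, the segment used below would meet the origin, where f² need not be
  -- C². In that case the left side is -μ f(v) ≤ 0.
  by_cases hopp : ∃ μ : ℝ, 0 ≤ μ ∧ w = -(μ • v)
  · obtain ⟨μ, hμ, rfl⟩ := hopp
    rw [map_neg, map_smul, hf.fderiv_fiber_self hu hv, smul_eq_mul]
    have := mul_nonneg hμ hfv.le
    linarith
  -- Scaling w so that f(l w) = f(v) turns the convexity inequality for f² into the linear
  -- inequality for f.
  · set l : ℝ := f u v / f u w with hl
    have hlpos : 0 < l := div_pos hfv hfw
    have key := hf.fderiv_fiber_sq_sub_le (v := v) (w := l • w) hu (by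
      intro t ht h0
      by_cases ht0 : t = 0
      · simp [ht0] at h0; exact hv h0
      have htpos : 0 < t := lt_of_le_of_ne ht.1 (Ne.symm ht0)
      refine hopp ⟨(1 - t) / (t * l), div_nonneg (by linarith [ht.2]) (by positivity), ?_⟩
      have h1 : (t * l) • w = -((1 - t) • v) := by
        rw [eq_neg_iff_add_eq_zero, ← h0, mul_smul, smul_sub, sub_smul, one_smul]; abel
      have h2 : w = (t * l)⁻¹ • ((t * l) • w) := by
        rw [smul_smul, inv_mul_cancel₀ (by positivity), one_smul]
      rw [h2, h1, smul_neg, smul_smul, div_eq_inv_mul])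
    rw [hf.fderiv_fiber_sq hu hv, map_sub, map_smul, hf.fderiv_fiber_self hu hv,
      hf.homog u hu w l hlpos.le, smul_eq_mul] at key
    have h1 : l * f u w = f u v := by rw [hl]; field_simp
    rw [h1] at key
    have h2 : l * fderiv ℝ (f u) v w ≤ f u v := by
      have h3 : 2 * f u v * (l * fderiv ℝ (f u) v w) ≤ 2 * f u v * f u v := by nlinarith
      exact le_of_mul_le_mul_left h3 (by positivity)
    rw [← h1] at h2
    exact le_of_mul_le_mul_left h2 hlpos

/-- The fundamental inequality is applied to w and to -w; both values appear because f need not be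
reversible. This keeps the momentum bounded near the centre in the Gauss lemma. -/
theorem abs_fderiv_fiber_sq_le (hf : IsLocalFinsler f U) {u v : E} (hu : u ∈ U) (hv : v ≠ 0)
    (w : E) : |fderiv ℝ (fun w => f u w ^ 2) v w| ≤ 2 * f u v * (f u w + f u (-w)) := by
  have h1 := hf.fderiv_fiber_le hu hv w
  have h2 := hf.fderiv_fiber_le hu hv (-w)
  rw [map_neg] at h2
  have h3 := hf.nonneg hu w
  have h4 := hf.nonneg hu (-w)
  rw [hf.fderiv_fiber_sq hu hv, abs_mul, abs_of_pos (by have := hf.pos u hu v hv; positivity)]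
  refine mul_le_mul_of_nonneg_left ?_ (by have := hf.nonneg hu v; positivity)
  rw [abs_le]; constructor <;> linarith

end IsLocalFinsler

/-! ### Euler-Lagrange equations in coordinates, energy and the Gauss lemma. -/

/-- The curve `(u, w)` in phase space has `u' = w` at time `t` and satisfies the Euler-Lagrange
equations of the Lagrangian `f²` there. -/
structure SolvesEulerLagrange {E : Type*} [NormedAddCommGroup E] [NormedSpace ℝ E]
    (f : E → E → ℝ) (u w : ℝ → E) (S : Set ℝ) (t : ℝ) : Prop where
  hasDerivWithinAt_position : HasDerivWithinAt u (w t) S t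
  differentiableWithinAt_velocity : DifferentiableWithinAt ℝ w S t
  euler_lagrange : ∀ e : E, HasDerivWithinAt
    (fun s : ℝ => fderiv ℝ (fun v => f (u s) v ^ 2) (w s) e)
    (fderiv ℝ (fun x => f x (w t) ^ 2) (u t) e) S t

namespace IsLocalFinsler

variable {E : Type*} [NormedAddCommGroup E] [NormedSpace ℝ E] {f : E → E → ℝ} {U : Set E}

theorem contDiffAt_fderiv_sq (hf : IsLocalFinsler f U) {u w : E} (hu : u ∈ U) (hw : w ≠ 0) :
    ContDiffAt ℝ ∞ (fderiv ℝ (fun p : E × E => f p.1 p.2 ^ 2)) (u, w) :=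
  (hf.contDiffAt_sq hu hw).fderiv_right (by simp)

theorem differentiableAt_fderiv_sq (hf : IsLocalFinsler f U) {u w : E} (hu : u ∈ U)
    (hw : w ≠ 0) : DifferentiableAt ℝ (fderiv ℝ (fun p : E × E => f p.1 p.2 ^ 2)) (u, w) :=
  (hf.contDiffAt_fderiv_sq hu hw).differentiableAt (by simp)

theorem eventually_mem (hf : IsLocalFinsler f U) {u w : ℝ → E} {S : Set ℝ} {t : ℝ}
    (hu : ContinuousWithinAt u S t) (hw : ContinuousWithinAt w S t) (hut : u t ∈ U)
    (hwt : w t ≠ 0) : ∀ᶠ s in 𝓝[S] t, u s ∈ U ∧ w s ≠ 0 :=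
  (hu.eventually (hf.isOpen.mem_nhds hut)).and
    (hw.eventually (isOpen_compl_singleton.mem_nhds hwt))

/-- The Euler-Lagrange equations as a second order equation. -/
theorem euler_lagrange_second_order (hf : IsLocalFinsler f U) {u w : ℝ → E} {S : Set ℝ} {t : ℝ}
    (h : SolvesEulerLagrange f u w S t) (hS : UniqueDiffWithinAt ℝ S t) (hut : u t ∈ U)
    (hwt : w t ≠ 0) (e : E) :
    fderiv ℝ (fderiv ℝ (fun p : E × E => f p.1 p.2 ^ 2)) (u t, w t)
      (w t, derivWithin w S t) (0, e) =
    fderiv ℝ (fun p : E × E => f p.1 p.2 ^ 2) (u t, w t) (e, 0) := by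
  have hu := h.hasDerivWithinAt_position
  have hw := h.differentiableWithinAt_velocity.hasDerivWithinAt
  have h1 := (hf.differentiableAt_fderiv_sq hut hwt).hasFDerivAt.comp_hasDerivWithinAt t
    (hu.prodMk hw)
  have h2 := h1.clm_apply (hasDerivWithinAt_const t S ((0 : E), e))
  have h3 : HasDerivWithinAt (fun s : ℝ => fderiv ℝ (fun v => f (u s) v ^ 2) (w s) e)
      (fderiv ℝ (fderiv ℝ (fun p : E × E => f p.1 p.2 ^ 2)) (u t, w t)
      (w t, derivWithin w S t) (0, e)) S t := by
    refine (h2.congr_of_eventuallyEq ?_ ?_).congr_deriv (by simp)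
    · filter_upwards [hf.eventually_mem hu.continuousWithinAt hw.continuousWithinAt hut hwt]
        with s hs
      exact hf.fderiv_fiber_sq_apply hs.1 hs.2 e
    · exact hf.fderiv_fiber_sq_apply hut hwt e
  rw [← hf.fderiv_base_sq_apply hut hwt]
  exact hS.eq_deriv S h3 (h.euler_lagrange e)

/-- The derivative of Euler's relation. -/
theorem fderiv_fderiv_sq_apply_self (hf : IsLocalFinsler f U) {u w : E} (hu : u ∈ U)
    (hw : w ≠ 0) (h k : E) :
    fderiv ℝ (fderiv ℝ (fun p : E × E => f p.1 p.2 ^ 2)) (u, w) (h, k) (0, w) +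
      fderiv ℝ (fun p : E × E => f p.1 p.2 ^ 2) (u, w) (0, k) =
    2 * fderiv ℝ (fun p : E × E => f p.1 p.2 ^ 2) (u, w) (h, k) := by
  have h1 : HasFDerivAt (fun p : E × E => ((0 : E), p.2))
      ((ContinuousLinearMap.inr ℝ E E).comp (ContinuousLinearMap.snd ℝ E E)) (u, w) :=
    ((ContinuousLinearMap.inr ℝ E E).comp (ContinuousLinearMap.snd ℝ E E)).hasFDerivAt
  have h2 := (hf.differentiableAt_fderiv_sq hu hw).hasFDerivAt.clm_apply h1
  have h3 := (hf.differentiableAt_sq hu hw).hasFDerivAt.const_mul 2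
  have h4 := h2.congr_of_eventuallyEq (f₁ := fun p : E × E => 2 * f p.1 p.2 ^ 2) (by
    filter_upwards [hf.isOpen_prod.mem_nhds ⟨hu, hw⟩] with p hp
    exact (hf.fderiv_sq_self hp.1 hp.2).symm)
  have h5 := congrArg (fun T : E × E →L[ℝ] ℝ => T (h, k)) (h4.unique h3)
  simp at h5
  linarith

/-- By homogeneity it is enough to bound f on the product of a compact neighbourhood and the unit
sphere. This replaces smoothness at zero vectors. -/
theorem exists_bound [FiniteDimensional ℝ E] (hf : IsLocalFinsler f U) {u₀ : E} (hu : u₀ ∈ U) :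
    ∃ C : ℝ, 0 ≤ C ∧ ∀ᶠ u in 𝓝 u₀, ∀ w, f u w ≤ C * ‖w‖ := by
  have : ProperSpace E := FiniteDimensional.proper ℝ E
  obtain ⟨K, hK, hKU, hKc⟩ := local_compact_nhds (hf.isOpen.mem_nhds hu)
  obtain ⟨C, hC⟩ := (hKc.prod (isCompact_sphere (0 : E) 1)).exists_bound_of_continuousOn
    (hf.contDiffOn.continuousOn.mono (by
      rintro ⟨x, w⟩ ⟨hx, hw⟩
      refine ⟨hKU hx, ?_⟩
      rintro rfl
      simp at hw))
  refine ⟨max C 0, le_max_right _ _, ?_⟩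
  filter_upwards [hK] with u hu w
  by_cases hw : w = 0
  · simp [hw, hf.map_zero (hKU hu)]
  have hn : 0 < ‖w‖ := norm_pos_iff.2 hw
  have h1 : f u w = ‖w‖ * f u (‖w‖⁻¹ • w) := by
    rw [← hf.homog u (hKU hu) _ _ hn.le, smul_smul, mul_inv_cancel₀ hn.ne', one_smul]
  have h2 := hC (u, ‖w‖⁻¹ • w) ⟨hu, by simp [norm_smul, hn.ne']⟩
  have h3 : f u (‖w‖⁻¹ • w) ≤ max C 0 := (le_abs_self _).trans (h2.trans (le_max_left _ _))
  rw [h1, mul_comm]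
  exact mul_le_mul_of_nonneg_right h3 hn.le

theorem continuousAt [FiniteDimensional ℝ E] (hf : IsLocalFinsler f U) {u w : E} (hu : u ∈ U) :
    ContinuousAt (fun p : E × E => f p.1 p.2) (u, w) := by
  by_cases hw : w = 0
  · subst hw
    obtain ⟨C, -, hC⟩ := hf.exists_bound hu
    unfold ContinuousAt
    simp only [hf.map_zero hu]
    refine squeeze_zero' (g := fun p : E × E => C * ‖p.2‖) ?_ ?_ ?_
    · filter_upwards [continuousAt_fst.eventually (hf.isOpen.mem_nhds hu)] with p hp
      exact hf.nonneg hp _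
    · filter_upwards [continuousAt_fst.eventually hC] with p hp
      exact hp _
    · have : Continuous fun p : E × E => C * ‖p.2‖ := by fun_prop
      simpa using this.tendsto (u, (0 : E))
  · exact (hf.contDiffAt hu hw).continuousAt

/-- Conservation of energy. -/
theorem hasDerivWithinAt_energy [FiniteDimensional ℝ E] (hf : IsLocalFinsler f U) {u w : ℝ → E}
    {S : Set ℝ} {t : ℝ} (h : SolvesEulerLagrange f u w S t) (hS : UniqueDiffWithinAt ℝ S t)
    (hut : u t ∈ U) : HasDerivWithinAt (fun s => f (u s) (w s) ^ 2) 0 S t := by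
  have hu := h.hasDerivWithinAt_position
  have hw := h.differentiableWithinAt_velocity.hasDerivWithinAt
  by_cases hwt : w t = 0
  -- At a zero of w the chain rule is not available. Since w = O(s - t) there, the energy is O((s -
  -- t)²) and its derivative vanishes.
  · obtain ⟨C, hC0, hC⟩ := hf.exists_bound hut
    have h0 : f (u t) (w t) ^ 2 = 0 := by simp [hwt, hf.map_zero hut]
    have hO : w =O[𝓝[S] t] fun s => s - t := by
      have := h.differentiableWithinAt_velocity.isBigO_sub
      simpa [hwt] using this
    have h2 : (fun s => f (u s) (w s) ^ 2) =O[𝓝[S] t] fun s => ‖w s‖ ^ 2 := by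
      refine Asymptotics.IsBigO.of_bound (C ^ 2) ?_
      filter_upwards [hu.continuousWithinAt.eventually hC,
        hu.continuousWithinAt.eventually (hf.isOpen.mem_nhds hut)] with s hs hsU
      rw [Real.norm_of_nonneg (sq_nonneg _), Real.norm_of_nonneg (sq_nonneg _), ← mul_pow]
      exact pow_le_pow_left₀ (hf.nonneg hsU _) (hs _) 2
    have h3 : (fun s => f (u s) (w s) ^ 2) =O[𝓝[S] t] fun s => (s - t) ^ 2 :=
      h2.trans (hO.norm_left.pow 2)
    rw [hasDerivWithinAt_iff_isLittleO]
    simp only [h0, sub_zero, smul_zero]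
    refine h3.trans_isLittleO ?_
    have h4 : (fun s : ℝ => (s - t) ^ 2) =o[𝓝 t] fun s => s - t :=
      by simpa using Asymptotics.isLittleO_pow_sub_sub t one_lt_two
    exact h4.mono nhdsWithin_le_nhds
  · have h1 := (hf.differentiableAt_sq hut hwt).hasFDerivAt.comp_hasDerivWithinAt t
      (hu.prodMk hw)
    refine HasDerivWithinAt.congr_deriv (f := fun s => f (u s) (w s) ^ 2) h1 ?_
    -- Write D for the differential of f². The equation tested against w and the differentiated
    -- Euler relation give D(w,0) + D(0,w') = 2 D(w,w'), so D(w,w') = 0.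
    have h2 := hf.euler_lagrange_second_order h hS hut hwt (w t)
    have h3 := hf.fderiv_fderiv_sq_apply_self hut hwt (w t) (derivWithin w S t)
    rw [h2, ← map_add] at h3
    simp at h3 ⊢
    linarith

/-- The Gauss lemma in polar coordinates: if the rays through the origin are geodesics along
which `f` is given by `ρ`, then `f u` has the same derivative as `ρ` at the radial vector `u`. -/
theorem fderiv_eq_of_rays (hf : IsLocalFinsler f U) {ρ : E → ℝ} {X : E} (hX : X ∈ U)
    (hX0 : X ≠ 0) (hstar : ∀ t ∈ Ioc (0 : ℝ) 1, ∀ᶠ Y in 𝓝 X, t • Y ∈ U)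
    (hρ : ∀ t ∈ Ioc (0 : ℝ) 1, ∀ᶠ Y in 𝓝 X, f (t • Y) Y = ρ Y)
    (hρX : DifferentiableAt ℝ ρ X)
    (hEL : ∀ t ∈ Ioc (0 : ℝ) 1, ∀ e, HasDerivWithinAt
      (fun s : ℝ => fderiv ℝ (fun v => f (s • X) v ^ 2) X e)
      (fderiv ℝ (fun x => f x X ^ 2) (t • X) e) (Icc 0 1) t)
    (hbdd : ∀ e : E, ∃ C, ∀ᶠ t : ℝ in 𝓝[>] 0, f (t • X) e ≤ C) (e : E) :
    fderiv ℝ ρ X e = fderiv ℝ (f X) X e := by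
  have htX : ∀ t ∈ Ioc (0 : ℝ) 1, t • X ∈ U := fun t ht => (hstar t ht).self_of_nhds
  -- m(t) is the momentum along the ray t ↦ tX in the direction e, and d is the derivative of ρ².
  -- The claim amounts to m(1) = d.
  set m : ℝ → ℝ := fun t => fderiv ℝ (fun v => f (t • X) v ^ 2) X e with hm
  set d : ℝ := fderiv ℝ (fun Y => ρ Y ^ 2) X e with hd
  have hρpos : 0 < ρ X := by
    rw [← (hρ 1 ⟨zero_lt_one, le_rfl⟩).self_of_nhds, one_smul]
    exact hf.pos X hX X hX0
  have hdρ : d = 2 * ρ X * fderiv ℝ ρ X e := by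
    have h' : HasFDerivAt (fun Y => ρ Y ^ 2) _ X := hρX.hasFDerivAt.pow 2
    rw [hd, h'.fderiv]
    simp
  -- This is the derivative of f(tY, Y)² = ρ(Y)² with respect to Y at X, in the direction e.
  have hrel : ∀ t ∈ Ioc (0 : ℝ) 1, m t + t * fderiv ℝ (fun x => f x X ^ 2) (t • X) e = d := by
    intro t ht
    have h1 : HasFDerivAt (fun Y : E => (t • Y, Y))
      ((t • ContinuousLinearMap.id ℝ E).prod (ContinuousLinearMap.id ℝ E)) X :=
      ((hasFDerivAt_id X).const_smul t).prodMk (hasFDerivAt_id X)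
    have h2 := (hf.differentiableAt_sq (htX t ht) hX0).hasFDerivAt.comp
      (f := fun Y : E => (t • Y, Y)) X h1
    have h3 := h2.congr_of_eventuallyEq (f₁ := fun Y => ρ Y ^ 2) (by
      filter_upwards [hρ t ht] with Y hY
      simp [hY])
    rw [hd, h3.fderiv, hm]
    simp only [hf.fderiv_fiber_sq_apply (htX t ht) hX0, hf.fderiv_base_sq_apply (htX t ht) hX0]
    rw [← smul_eq_mul, ← map_smul, ← map_add]
    simp
  -- The Euler-Lagrange equation gives (t m)' = m + t m' = d, by `hrel`. So t(m - d) is constant on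
  -- (0,1].
  have hder : ∀ t ∈ Ioc (0 : ℝ) 1, HasDerivWithinAt (fun s => s * m s - s * d) 0 (Icc 0 1) t := by
    intro t ht
    have h1 := ((hasDerivWithinAt_id t (Icc (0 : ℝ) 1)).mul (hEL t ht e)).sub
      ((hasDerivWithinAt_id t (Icc (0 : ℝ) 1)).mul_const d)
    refine h1.congr_deriv ?_
    have := hrel t ht
    simp only [hm] at this
    simp only [id, one_mul]
    linarith
  have hconst : ∀ t ∈ Ioc (0 : ℝ) 1, t * m t - t * d = m 1 - d := by
    intro t ht
    have hsub : Icc t 1 ⊆ Icc (0 : ℝ) 1 := Icc_subset_Icc ht.1.le le_rfl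
    have hD : ∀ s ∈ Icc t 1, HasDerivWithinAt (fun s => s * m s - s * d) 0 (Icc t 1) s :=
      fun s hs => (hder s ⟨ht.1.trans_le hs.1, hs.2⟩).mono hsub
    have := constant_of_has_deriv_right_zero (fun s hs => (hD s hs).continuousWithinAt)
      (fun s hs => (hD s (Ico_subset_Icc_self hs)).mono_of_mem_nhdsWithin
        (Icc_mem_nhdsGE_of_mem hs)) 1 (right_mem_Icc.2 ht.2)
    simpa using this.symm
  obtain ⟨C₁, hC₁⟩ := hbdd e
  obtain ⟨C₂, hC₂⟩ := hbdd (-e)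
  -- The constant is zero: m stays bounded as t → 0, because f(tX, ±e) does.
  have hlim : Tendsto (fun t : ℝ => t * m t - t * d) (𝓝[>] 0) (𝓝 0) := by
    rw [tendsto_zero_iff_abs_tendsto_zero]
    refine squeeze_zero' (g := fun t : ℝ => t * (2 * ρ X * (C₁ + C₂) + |d|))
      (Eventually.of_forall fun t => abs_nonneg _) ?_ ?_
    · filter_upwards [hC₁, hC₂, Ioc_mem_nhdsGT (zero_lt_one' ℝ)] with t h1 h2 ht
      have h3 := hf.abs_fderiv_fiber_sq_le (htX t ht) hX0 e
      rw [(hρ t ht).self_of_nhds] at h3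
      simp only [Function.comp]
      rw [← mul_sub, abs_mul, abs_of_pos ht.1]
      refine mul_le_mul_of_nonneg_left ?_ ht.1.le
      refine (abs_sub _ _).trans (add_le_add_left (h3.trans ?_) _)
      exact mul_le_mul_of_nonneg_left (add_le_add h1 h2) (by positivity)
    · have : Continuous fun t : ℝ => t * (2 * ρ X * (C₁ + C₂) + |d|) := by fun_prop
      simpa using (this.tendsto 0).mono_left nhdsWithin_le_nhds
  have hlim' : Tendsto (fun t : ℝ => t * m t - t * d) (𝓝[>] 0) (𝓝 (m 1 - d)) := by
    refine tendsto_const_nhds.congr' ?_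
    filter_upwards [Ioc_mem_nhdsGT (zero_lt_one' ℝ)] with t ht
    exact (hconst t ht).symm
  have hmd : m 1 = d := sub_eq_zero.1 (tendsto_nhds_unique hlim' hlim)
  have hm1 : m 1 = 2 * ρ X * fderiv ℝ (f X) X e := by
    simp only [hm, one_smul]
    rw [hf.fderiv_fiber_sq hX hX0]
    have := (hρ 1 ⟨zero_lt_one, le_rfl⟩).self_of_nhds
    rw [one_smul] at this
    rw [this]
  rw [hm1, hdρ] at hmd
  exact (mul_left_cancel₀ (by positivity) hmd).symm

end IsLocalFinsler

/-! ### The geodesic spray and local uniqueness at nonzero velocity. -/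

section Spray

variable {E : Type*} [NormedAddCommGroup E] [NormedSpace ℝ E]

/-- The fibre Hessian of `f²`, as a map into the dual space. -/
noncomputable def fiberHessian (f : E → E → ℝ) (p : E × E) : E →L[ℝ] E →L[ℝ] ℝ :=
  (((ContinuousLinearMap.compL ℝ E (E × E) ℝ).flip (ContinuousLinearMap.inr ℝ E E)).comp
    (fderiv ℝ (fderiv ℝ (fun p : E × E => f p.1 p.2 ^ 2)) p)).comp (ContinuousLinearMap.inr ℝ E E)

/-- The force term of the Euler-Lagrange equations of `f²`. -/
noncomputable def forceTerm (f : E → E → ℝ) (p : E × E) : E →L[ℝ] ℝ :=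
  (fderiv ℝ (fun p : E × E => f p.1 p.2 ^ 2) p).comp (ContinuousLinearMap.inl ℝ E E) -
    (fderiv ℝ (fderiv ℝ (fun p : E × E => f p.1 p.2 ^ 2)) p (p.2, 0)).comp
      (ContinuousLinearMap.inr ℝ E E)

/-- The acceleration of a geodesic as a function of position and velocity. -/
noncomputable def geodesicAcceleration (f : E → E → ℝ) (p : E × E) : E :=
  (fiberHessian f p).inverse (forceTerm f p)

theorem fiberHessian_apply (f : E → E → ℝ) (p : E × E) (Y e : E) :
    fiberHessian f p Y e =
      fderiv ℝ (fderiv ℝ (fun p : E × E => f p.1 p.2 ^ 2)) p (0, Y) (0, e) := rfl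

theorem forceTerm_apply (f : E → E → ℝ) (p : E × E) (e : E) :
    forceTerm f p e = fderiv ℝ (fun p : E × E => f p.1 p.2 ^ 2) p (e, 0) -
      fderiv ℝ (fderiv ℝ (fun p : E × E => f p.1 p.2 ^ 2)) p (p.2, 0) (0, e) := rfl

end Spray

namespace IsLocalFinsler

variable {E : Type*} [NormedAddCommGroup E] [NormedSpace ℝ E] {f : E → E → ℝ} {U : Set E}

/-- The value on (Y, Y) is the second derivative of f² along the line t ↦ w + tY. -/
theorem fiberHessian_self_pos (hf : IsLocalFinsler f U) {u w Y : E} (hu : u ∈ U) (hw : w ≠ 0)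
    (hY : Y ≠ 0) : 0 < fiberHessian f (u, w) Y Y := by
  have h0 : w + (0 : ℝ) • Y ≠ 0 := by simpa using hw
  have h := hf.deriv_deriv_line_pos hu h0 hY
  have hc : ContinuousAt (fun t : ℝ => w + t • Y) 0 := by fun_prop
  have h1 : deriv (fun t : ℝ => f u (w + t • Y) ^ 2) =ᶠ[𝓝 0] fun t =>
      fderiv ℝ (fun p : E × E => f p.1 p.2 ^ 2) (u, w + t • Y) (0, Y) := by
    filter_upwards [hc.eventually (isOpen_compl_singleton.mem_nhds h0)] with t ht
    rw [hf.deriv_line hu ht, hf.fderiv_fiber_sq_apply hu ht]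
  have h2 : HasDerivAt (fun t : ℝ => (u, w + t • Y)) ((0 : E), Y) 0 := by
    have h3 : HasDerivAt (fun t : ℝ => w + t • Y) Y 0 := by
      simpa using (((hasDerivAt_id (0 : ℝ)).smul_const Y).const_add w :)
    exact (hasDerivAt_const 0 u).prodMk h3
  have h4 : HasDerivAt
      (fun t : ℝ => fderiv ℝ (fun p : E × E => f p.1 p.2 ^ 2) (u, w + t • Y) (0, Y)) _ 0 :=
    ((hf.differentiableAt_fderiv_sq hu h0).hasFDerivAt.comp_hasDerivAt
      (f := fun t : ℝ => (u, w + t • Y)) 0 h2).clm_apply (hasDerivAt_const 0 ((0 : E), Y))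
  rw [h1.deriv_eq, h4.deriv] at h
  simpa [fiberHessian_apply] using h

/-- Definiteness gives injectivity, and E and its dual have the same finite dimension. -/
theorem isInvertible_fiberHessian [FiniteDimensional ℝ E] (hf : IsLocalFinsler f U) {u w : E}
    (hu : u ∈ U) (hw : w ≠ 0) : (fiberHessian f (u, w)).IsInvertible := by
  have hinj : Function.Injective (fiberHessian f (u, w)) := by
    rw [injective_iff_map_eq_zero]
    intro Y hY
    by_contra hY0
    have := hf.fiberHessian_self_pos hu hw hY0
    simp [hY] at this
  have hdim : Module.finrank ℝ E = Module.finrank ℝ (E →L[ℝ] ℝ) := by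
    rw [← (LinearMap.toContinuousLinearMap (𝕜 := ℝ) (E := E) (F' := ℝ)).finrank_eq]
    exact (Subspace.dual_finrank_eq (K := ℝ) (V := E)).symm
  let e : E ≃ₗ[ℝ] (E →L[ℝ] ℝ) := LinearEquiv.ofInjectiveOfFinrankEq
    (fiberHessian f (u, w) : E →ₗ[ℝ] (E →L[ℝ] ℝ)) hinj hdim
  exact ⟨e.toContinuousLinearEquiv, by ext; rfl⟩

theorem contDiffAt_geodesicAcceleration [FiniteDimensional ℝ E] (hf : IsLocalFinsler f U)
    {u w : E} (hu : u ∈ U) (hw : w ≠ 0) : ContDiffAt ℝ 1 (geodesicAcceleration f) (u, w) := by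
  have : CompleteSpace E := FiniteDimensional.complete ℝ E
  have h1 : ContDiffAt ℝ 1 (fderiv ℝ (fun p : E × E => f p.1 p.2 ^ 2)) (u, w) :=
    (hf.contDiffAt_fderiv_sq hu hw).of_le (by norm_cast)
  have h2 : ContDiffAt ℝ 1 (fderiv ℝ (fderiv ℝ (fun p : E × E => f p.1 p.2 ^ 2))) (u, w) :=
    (hf.contDiffAt_fderiv_sq hu hw).fderiv_right (by norm_cast)
  have hA : ContDiffAt ℝ 1 (fiberHessian f) (u, w) :=
    (contDiffAt_const.clm_comp h2).clm_comp contDiffAt_const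
  have hb : ContDiffAt ℝ 1 (forceTerm f) (u, w) :=
    (h1.clm_comp contDiffAt_const).sub
      ((h2.clm_apply (contDiffAt_snd.prodMk contDiffAt_const)).clm_comp contDiffAt_const)
  exact ((hf.isInvertible_fiberHessian hu hw).contDiffAt_map_inverse.comp (u, w) hA).clm_apply hb

/-- The second order equation is linear in w', with the fibre Hessian as its matrix; solving it puts
the geodesic equation in explicit form. -/
theorem derivWithin_velocity [FiniteDimensional ℝ E] (hf : IsLocalFinsler f U) {u w : ℝ → E}
    {S : Set ℝ} {t : ℝ} (h : SolvesEulerLagrange f u w S t) (hS : UniqueDiffWithinAt ℝ S t)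
    (hut : u t ∈ U) (hwt : w t ≠ 0) :
    derivWithin w S t = geodesicAcceleration f (u t, w t) := by
  have hA : fiberHessian f (u t, w t) (derivWithin w S t) = forceTerm f (u t, w t) := by
    ext e
    rw [fiberHessian_apply, forceTerm_apply, ← hf.euler_lagrange_second_order h hS hut hwt,
      ← _root_.sub_apply, ← map_sub]
    simp
  obtain ⟨T, hT⟩ := hf.isInvertible_fiberHessian hut hwt
  rw [geodesicAcceleration, ← hA, ← hT, ContinuousLinearMap.inverse_equiv]
  simp

/-- Local forward uniqueness for the geodesic equation at a nonzero velocity. -/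
theorem exists_eqOn_Icc_of_solves [FiniteDimensional ℝ E] (hf : IsLocalFinsler f U)
    {u₁ w₁ u₂ w₂ : ℝ → E} {a b t₀ t₁ : ℝ} (ha : a ≤ t₀) (h01 : t₀ < t₁) (hb : t₁ ≤ b)
    (h₁ : ∀ t ∈ Icc t₀ t₁, SolvesEulerLagrange f u₁ w₁ (Icc a b) t)
    (h₂ : ∀ t ∈ Icc t₀ t₁, SolvesEulerLagrange f u₂ w₂ (Icc a b) t)
    (hU : u₁ t₀ ∈ U) (hw : w₁ t₀ ≠ 0) (hu12 : u₁ t₀ = u₂ t₀) (hw12 : w₁ t₀ = w₂ t₀) :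
    ∃ t₂ ∈ Ioc t₀ t₁, EqOn u₁ u₂ (Icc t₀ t₂) := by
  -- The first order system (u,w)' = (w, acceleration) has a C¹ right side near the initial point,
  -- hence a Lipschitz one. Both solutions stay in the Lipschitz region for a short time, and there
  -- the uniqueness theorem for ODEs applies.
  have hV : ContDiffAt ℝ 1 (fun p : E × E => (p.2, geodesicAcceleration f p)) (u₁ t₀, w₁ t₀) :=
    contDiffAt_snd.prodMk (hf.contDiffAt_geodesicAcceleration hU hw)
  obtain ⟨K, s, hs, hLip⟩ := hV.exists_lipschitzOnWith
  have hsub : Icc t₀ t₁ ⊆ Icc a b := Icc_subset_Icc ha hb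
  have hs' : s ∩ U ×ˢ {0}ᶜ ∈ 𝓝 (u₁ t₀, w₁ t₀) :=
    inter_mem hs (hf.isOpen_prod.mem_nhds ⟨hU, hw⟩)
  have hcont : ∀ {u w : ℝ → E}, (∀ t ∈ Icc t₀ t₁, SolvesEulerLagrange f u w (Icc a b) t) →
      ContinuousOn (fun t => (u t, w t)) (Icc t₀ t₁) := fun h t ht =>
    ((h t ht).hasDerivWithinAt_position.continuousWithinAt.prodMk
      (h t ht).differentiableWithinAt_velocity.continuousWithinAt).mono hsub
  have hev : ∀ {u w : ℝ → E}, (∀ t ∈ Icc t₀ t₁, SolvesEulerLagrange f u w (Icc a b) t) →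
      u₁ t₀ = u t₀ → w₁ t₀ = w t₀ → ∀ᶠ t in 𝓝[≥] t₀, (u t, w t) ∈ s ∩ U ×ˢ {0}ᶜ := by
    intro u w h hu hw
    rw [← nhdsWithin_Icc_eq_nhdsGE h01]
    refine (hcont h t₀ (left_mem_Icc.2 h01.le)).eventually ?_
    simp only [← hu, ← hw]
    exact hs'
  obtain ⟨t₂, ht₂, hin⟩ := (mem_nhdsGE_iff_exists_mem_Ioc_Ico_subset h01).1
    ((hev h₁ rfl rfl).and (hev h₂ hu12 hw12))
  have hsub2 : Icc t₀ t₂ ⊆ Icc t₀ t₁ := Icc_subset_Icc le_rfl ht₂.2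
  have hder : ∀ {u w : ℝ → E}, (∀ t ∈ Icc t₀ t₁, SolvesEulerLagrange f u w (Icc a b) t) →
      (∀ t ∈ Ico t₀ t₂, (u t, w t) ∈ s ∩ U ×ˢ {0}ᶜ) → ∀ t ∈ Ico t₀ t₂,
      HasDerivWithinAt (fun t => (u t, w t))
        ((fun p : E × E => (p.2, geodesicAcceleration f p)) (u t, w t)) (Ici t) t := by
    intro u w h hmem t ht
    have ht' : t ∈ Icc t₀ t₁ := hsub2 (Ico_subset_Icc_self ht)
    have hab : a < b := (ha.trans_lt h01).trans_le hb
    have h3 := (h t ht').differentiableWithinAt_velocity.hasDerivWithinAt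
    rw [hf.derivWithin_velocity (h t ht') (uniqueDiffOn_Icc hab t (hsub ht'))
      (hmem t ht).2.1 (hmem t ht).2.2] at h3
    exact ((h t ht').hasDerivWithinAt_position.prodMk h3).mono_of_mem_nhdsWithin
      (Icc_mem_nhdsGE_of_mem ⟨(hsub ht').1, ht.2.trans_le (ht₂.2.trans hb)⟩)
  refine ⟨t₂, ht₂, ?_⟩
  have huniq := ODE_solution_unique_of_mem_Icc_right
    (v := fun _ p => (p.2, geodesicAcceleration f p)) (s := fun _ => s) (fun _ _ => hLip)
    ((hcont h₁).mono hsub2) (hder h₁ fun t ht => (hin ht).1) (fun t ht => (hin ht).1.1)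
    ((hcont h₂).mono hsub2) (hder h₂ fun t ht => (hin ht).2) (fun t ht => (hin ht).2.1)
    (by simp only [hu12, hw12])
  exact fun t ht => congrArg Prod.fst (huniq ht)

end IsLocalFinsler

/-! ### Passage from the manifold to charts. -/

namespace FinslerMetric

variable {n : ℕ} {M : Type*} [TopologicalSpace M] [ChartedSpace (EuclideanSpace ℝ (Fin n)) M]
  [IsManifold (𝓡 n) ∞ M]

/-- The derivative of the inverse of a chart, as an endomorphism of the model space. -/
noncomputable def symmDeriv (φ : OpenPartialHomeomorph M (EuclideanSpace ℝ (Fin n)))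
    (u : EuclideanSpace ℝ (Fin n)) : EuclideanSpace ℝ (Fin n) →L[ℝ] EuclideanSpace ℝ (Fin n) :=
  mfderiv (𝓡 n) (𝓡 n) φ.symm u

/-- The expression of `F` in the coordinates of `TM` induced by a chart `φ` of `M`. -/
noncomputable def inChart (F : FinslerMetric n M)
    (φ : OpenPartialHomeomorph M (EuclideanSpace ℝ (Fin n))) (u w : EuclideanSpace ℝ (Fin n)) : ℝ :=
  F.toFun ⟨φ.symm u, symmDeriv φ u w⟩

theorem sqInChart_eq (F : FinslerMetric n M)
    (φ : OpenPartialHomeomorph M (EuclideanSpace ℝ (Fin n))) (u w : EuclideanSpace ℝ (Fin n)) :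
    F.sqInChart φ u w = F.inChart φ u w ^ 2 := rfl

theorem map_zero (F : FinslerMetric n M) (x : M) : F.toFun ⟨x, (0 : TangentSpace (𝓡 n) x)⟩ = 0 := by
  simpa using F.homogeneous x 0 0 le_rfl

theorem nonneg (F : FinslerMetric n M) (v : TangentBundle (𝓡 n) M) : 0 ≤ F.toFun v := by
  obtain ⟨x, X⟩ := v
  by_cases hX : X = 0
  · rw [hX, F.map_zero]
  · exact (F.pos x X hX).le

end FinslerMetric

section Charts

variable {n : ℕ} {M : Type*} [TopologicalSpace M] [ChartedSpace (EuclideanSpace ℝ (Fin n)) M]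
  {φ : OpenPartialHomeomorph M (EuclideanSpace ℝ (Fin n))}

theorem tangentBundle_mk_congr {p q : M} {X Y : EuclideanSpace ℝ (Fin n)}
    (hpq : p = q) (hXY : X = Y) :
    (⟨p, X⟩ : TangentBundle (𝓡 n) M) = (⟨q, Y⟩ : TangentBundle (𝓡 n) M) := by
  subst hpq hXY
  rfl

theorem mdifferentiable_of_mem_maximalAtlas (hφ : φ ∈ IsManifold.maximalAtlas (𝓡 n) ∞ M) :
    φ.MDifferentiable (𝓡 n) (𝓡 n) :=
  ⟨(contMDiffOn_of_mem_maximalAtlas hφ).mdifferentiableOn (by simp),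
    (contMDiffOn_symm_of_mem_maximalAtlas hφ).mdifferentiableOn (by simp)⟩

theorem symmDeriv_ne_zero (hφ : φ ∈ IsManifold.maximalAtlas (𝓡 n) ∞ M)
    {u : EuclideanSpace ℝ (Fin n)} {w : EuclideanSpace ℝ (Fin n)} (hu : u ∈ φ.target)
    (hw : w ≠ 0) : FinslerMetric.symmDeriv φ u w ≠ 0 := by
  have h : Function.Injective (FinslerMetric.symmDeriv φ u) :=
    (mdifferentiable_of_mem_maximalAtlas hφ).symm.mfderiv_injective hu
  exact fun h0 => hw (h (h0.trans (map_zero _).symm))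

theorem hasDerivWithinAt_chart_comp (hφ : φ ∈ IsManifold.maximalAtlas (𝓡 n) ∞ M) {c : ℝ → M}
    {S : Set ℝ} {t : ℝ} (hc : MDifferentiableWithinAt 𝓘(ℝ, ℝ) (𝓡 n) c S t)
    (ht : c t ∈ φ.source) : HasDerivWithinAt (fun r => φ (c r))
      (mfderiv (𝓡 n) (𝓡 n) φ (c t) (mfderivWithin 𝓘(ℝ, ℝ) (𝓡 n) c S t (1 : ℝ))) S t := by
  have h1 := ((mdifferentiable_of_mem_maximalAtlas hφ).mdifferentiableAt ht).hasMFDerivAt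
  let A : EuclideanSpace ℝ (Fin n) →L[ℝ] EuclideanSpace ℝ (Fin n) :=
    mfderiv (𝓡 n) (𝓡 n) φ (c t)
  let B : ℝ →L[ℝ] EuclideanSpace ℝ (Fin n) := mfderivWithin 𝓘(ℝ, ℝ) (𝓡 n) c S t
  have h2 : HasFDerivWithinAt (fun r => φ (c r)) (A.comp B) S t :=
    (h1.comp_hasMFDerivWithinAt t hc.hasMFDerivWithinAt).hasFDerivWithinAt
  exact h2.hasDerivWithinAt

theorem derivWithin_chart_comp (hφ : φ ∈ IsManifold.maximalAtlas (𝓡 n) ∞ M) {c : ℝ → M}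
    {S : Set ℝ} {t : ℝ} (hc : MDifferentiableWithinAt 𝓘(ℝ, ℝ) (𝓡 n) c S t)
    (hS : UniqueDiffWithinAt ℝ S t)
    (ht : c t ∈ φ.source) : derivWithin (fun r => φ (c r)) S t =
      mfderiv (𝓡 n) (𝓡 n) φ (c t) (mfderivWithin 𝓘(ℝ, ℝ) (𝓡 n) c S t (1 : ℝ)) :=
  (hasDerivWithinAt_chart_comp hφ hc ht).derivWithin hS

variable [IsManifold (𝓡 n) ∞ M]

/-- This is the smooth parametrization of TM over a chart domain, through which smoothness of F
becomes smoothness of `inChart`. -/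
theorem contMDiffOn_tangentMap_symm (hφ : φ ∈ IsManifold.maximalAtlas (𝓡 n) ∞ M) :
    ContMDiffOn 𝓘(ℝ, EuclideanSpace ℝ (Fin n) × EuclideanSpace ℝ (Fin n)) (𝓡 n).tangent ∞
      (fun p : EuclideanSpace ℝ (Fin n) × EuclideanSpace ℝ (Fin n) =>
        (⟨φ.symm p.1, FinslerMetric.symmDeriv φ p.1 p.2⟩ : TangentBundle (𝓡 n) M))
      (φ.target ×ˢ univ) := by
  have h1 : ContMDiffOn (𝓡 n).tangent (𝓡 n).tangent ∞
      (tangentMapWithin (𝓡 n) (𝓡 n) φ.symm φ.target)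
      (Bundle.TotalSpace.proj ⁻¹' φ.target) :=
    (contMDiffOn_symm_of_mem_maximalAtlas hφ).contMDiffOn_tangentMapWithin (by norm_cast)
      φ.open_target.uniqueMDiffOn
  have h2 := contMDiff_tangentBundleModelSpaceHomeomorph_symm (I := 𝓡 n) (n := ∞)
  have h3 : ContMDiff 𝓘(ℝ, EuclideanSpace ℝ (Fin n) × EuclideanSpace ℝ (Fin n)) (𝓡 n).tangent ∞
      (fun p : EuclideanSpace ℝ (Fin n) × EuclideanSpace ℝ (Fin n) =>
        (⟨p.1, p.2⟩ : TangentBundle (𝓡 n) (EuclideanSpace ℝ (Fin n)))) := by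
    rw [modelWithCornersSelf_prod]
    exact h2
  refine (h1.comp (h3.contMDiffOn (s := φ.target ×ˢ univ)) fun p hp => hp.1).congr ?_
  rintro ⟨u, w⟩ ⟨hu, -⟩
  simp only [Function.comp, tangentMapWithin]
  rw [mfderivWithin_of_isOpen φ.open_target hu]
  rfl

/-- The derivative of φ⁻¹ is linear and injective on each fibre, so every axiom is transported. -/
theorem FinslerMetric.isLocalFinsler_inChart (F : FinslerMetric n M)
    (hφ : φ ∈ IsManifold.maximalAtlas (𝓡 n) ∞ M) : IsLocalFinsler (F.inChart φ) φ.target where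
  isOpen := φ.open_target
  contDiffOn := by
    rw [← contMDiffOn_iff_contDiffOn]
    refine F.smooth.comp ((contMDiffOn_tangentMap_symm hφ).mono
      (prod_mono_right (subset_univ _))) ?_
    rintro ⟨u, w⟩ ⟨hu, hw⟩
    exact symmDeriv_ne_zero hφ hu hw
  pos u hu w hw := F.pos _ _ (symmDeriv_ne_zero hφ hu hw)
  homog u _ w r hr := by
    unfold inChart
    rw [map_smul]
    exact F.homogeneous _ _ r hr
  hess_pos u hu v Y hv hY := by
    have h := F.convex (φ.symm u) (symmDeriv φ u v) (symmDeriv φ u Y) (symmDeriv_ne_zero hφ hu hv)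
      (symmDeriv_ne_zero hφ hu hY)
    set q : ℝ → ℝ := fun t => F.inChart φ u (v + t • Y) ^ 2 with hq
    -- With both arguments of the tensor equal, the mixed derivative is that of q(s + t), hence the
    -- second derivative of q.
    have h2 : ∀ s t : ℝ, F.toFun ⟨φ.symm u, symmDeriv φ u v + s • symmDeriv φ u Y +
        t • symmDeriv φ u Y⟩ ^ 2 = q (s + t) := by
      intro s t
      simp only [hq, inChart]
      rw [add_smul, ← add_assoc, map_add, map_add, map_smul, map_smul]
    have h : 0 < (1 / 2 : ℝ) * deriv (fun s : ℝ => deriv (fun t : ℝ => F.toFun ⟨φ.symm u,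
        symmDeriv φ u v + s • symmDeriv φ u Y + t • symmDeriv φ u Y⟩ ^ 2) 0) 0 := h
    simp only [h2] at h
    have h3 : (fun s : ℝ => deriv (fun t : ℝ => q (s + t)) 0) = deriv q := by
      funext s
      simpa using deriv_comp_const_add q s 0
    rw [h3] at h
    linarith

theorem FinslerMetric.inChart_derivWithin (F : FinslerMetric n M)
    (hφ : φ ∈ IsManifold.maximalAtlas (𝓡 n) ∞ M) {c : ℝ → M} {a b t : ℝ}
    (hc : MDifferentiableWithinAt 𝓘(ℝ, ℝ) (𝓡 n) c (Icc a b) t)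
    (hS : UniqueDiffWithinAt ℝ (Icc a b) t) (ht : c t ∈ φ.source) :
    F.inChart φ (φ (c t)) (derivWithin (fun r => φ (c r)) (Icc a b) t) =
      F.toFun (velocity n c a b t) := by
  rw [derivWithin_chart_comp hφ hc hS ht]
  unfold inChart velocity
  have h := congrArg (fun T => T (mfderivWithin 𝓘(ℝ, ℝ) (𝓡 n) c (Icc a b) t (1 : ℝ)))
    ((mdifferentiable_of_mem_maximalAtlas hφ).symm_comp_deriv ht)
  have h' : symmDeriv φ (φ (c t)) (mfderiv (𝓡 n) (𝓡 n) φ (c t)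
    (mfderivWithin 𝓘(ℝ, ℝ) (𝓡 n) c (Icc a b) t (1 : ℝ))) =
      mfderivWithin 𝓘(ℝ, ℝ) (𝓡 n) c (Icc a b) t (1 : ℝ) := h
  rw [h']
  exact congrArg F.toFun (tangentBundle_mk_congr (φ.left_inv ht) rfl)

end Charts

/-! ### Constant speed and uniqueness of geodesics. -/

namespace FinslerMetric

variable {n : ℕ} {M : Type*} [TopologicalSpace M] [ChartedSpace (EuclideanSpace ℝ (Fin n)) M]
  [IsManifold (𝓡 n) ∞ M] {φ : OpenPartialHomeomorph M (EuclideanSpace ℝ (Fin n))}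
  {F : FinslerMetric n M} {c : ℝ → M} {a b : ℝ}

theorem IsGeodesic.mdifferentiableWithinAt (hc : F.IsGeodesic c a b) {t : ℝ} (ht : t ∈ Icc a b) :
    MDifferentiableWithinAt 𝓘(ℝ, ℝ) (𝓡 n) c (Icc a b) t :=
  (hc.1 t ht).mdifferentiableWithinAt (by simp)

theorem IsGeodesic.contDiffWithinAt_chart (hc : F.IsGeodesic c a b)
    (hφ : φ ∈ IsManifold.maximalAtlas (𝓡 n) ∞ M) {t : ℝ} (ht : t ∈ Icc a b)
    (hct : c t ∈ φ.source) : ContDiffWithinAt ℝ 2 (fun r => φ (c r)) (Icc a b) t := by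
  rw [← contMDiffWithinAt_iff_contDiffWithinAt]
  have h : ContMDiffAt (𝓡 n) (𝓡 n) 2 φ (c t) :=
    (contMDiffAt_of_mem_maximalAtlas hφ hct).of_le (by norm_cast)
  exact h.comp_contMDiffWithinAt t (hc.1 t ht)

theorem IsGeodesic.solvesEulerLagrange (hc : F.IsGeodesic c a b) (hab : a < b)
    (hφ : φ ∈ IsManifold.maximalAtlas (𝓡 n) ∞ M) {t : ℝ} (ht : t ∈ Icc a b)
    (hct : c t ∈ φ.source) :
    SolvesEulerLagrange (F.inChart φ) (fun r => φ (c r))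
      (derivWithin (fun r => φ (c r)) (Icc a b)) (Icc a b) t where
  hasDerivWithinAt_position :=
    ((hc.contDiffWithinAt_chart hφ ht hct).differentiableWithinAt (by simp)).hasDerivWithinAt
  differentiableWithinAt_velocity :=
    ((hc.contDiffWithinAt_chart hφ ht hct).derivWithin (uniqueDiffOn_Icc hab)
      (m := 1) (by norm_cast) ht).differentiableWithinAt (by simp)
  euler_lagrange e := hc.2 φ hφ t ht hct e

/-- Geodesics have constant speed. -/
theorem IsGeodesic.speed_eq (hc : F.IsGeodesic c a b) (hab : a < b) {t : ℝ}
    (ht : t ∈ Icc a b) : F.toFun (velocity n c a b t) = F.toFun (velocity n c a b a) := by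
  have hD : ∀ s ∈ Icc a b,
      HasDerivWithinAt (fun r => F.toFun (velocity n c a b r) ^ 2) 0 (Icc a b) s := by
    intro s hs
    have hφ : chartAt (EuclideanSpace ℝ (Fin n)) (c s) ∈ IsManifold.maximalAtlas (𝓡 n) ∞ M :=
      IsManifold.chart_mem_maximalAtlas (c s)
    have hcs := mem_chart_source (EuclideanSpace ℝ (Fin n)) (c s)
    have h1 := (F.isLocalFinsler_inChart hφ).hasDerivWithinAt_energy
      (hc.solvesEulerLagrange hab hφ hs hcs) (uniqueDiffOn_Icc hab s hs)
      ((chartAt _ (c s)).map_source hcs)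
    have h2 : ∀ r ∈ Icc a b, c r ∈ (chartAt (EuclideanSpace ℝ (Fin n)) (c s)).source →
        F.toFun (velocity n c a b r) ^ 2 = _ := fun r hr hcr => by
      rw [← F.inChart_derivWithin hφ (hc.mdifferentiableWithinAt hr)
        (uniqueDiffOn_Icc hab r hr) hcr]
    refine h1.congr_of_eventuallyEq ?_ (h2 s hs hcs)
    filter_upwards [self_mem_nhdsWithin, (hc.1 s hs).continuousWithinAt.eventually
      ((chartAt (EuclideanSpace ℝ (Fin n)) (c s)).open_source.mem_nhds hcs)] with r hr hcr
    exact h2 r hr hcr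
  have := constant_of_has_deriv_right_zero (fun s hs => (hD s hs).continuousWithinAt)
      (fun s hs => (hD s (Ico_subset_Icc_self hs)).mono_of_mem_nhdsWithin
        (Icc_mem_nhdsGE_of_mem hs)) t ht
  exact (pow_left_inj₀ (F.nonneg _) (F.nonneg _) two_ne_zero).1 this

theorem IsGeodesic.length_eq (hc : F.IsGeodesic c a b) (hab : a < b) :
    F.length c a b = (b - a) * F.toFun (velocity n c a b a) := by
  unfold length
  rw [intervalIntegral.integral_congr (g := fun _ => F.toFun (velocity n c a b a))]
  · simp
  · intro t ht
    rw [uIcc_of_le hab.le] at ht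
    exact hc.speed_eq hab ht

/-- Two geodesics which have the same position and velocity at one time agree for some time. -/
theorem IsGeodesic.exists_eqOn_of_derivWithin_eq {c₁ c₂ : ℝ → M} (h₁ : F.IsGeodesic c₁ a b)
    (h₂ : F.IsGeodesic c₂ a b) {t₀ : ℝ} (ht₀ : t₀ ∈ Ico a b)
    (hφ : φ ∈ IsManifold.maximalAtlas (𝓡 n) ∞ M) (hs : c₁ t₀ ∈ φ.source) (h12 : c₁ t₀ = c₂ t₀)
    (hd : derivWithin (fun r => φ (c₁ r)) (Icc a b) t₀ =
      derivWithin (fun r => φ (c₂ r)) (Icc a b) t₀) :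
    ∃ t₂ ∈ Ioc t₀ b, EqOn c₁ c₂ (Icc t₀ t₂) := by
  have hab : a < b := ht₀.1.trans_lt ht₀.2
  have ht₀' : t₀ ∈ Icc a b := Ico_subset_Icc_self ht₀
  have hev : ∀ᶠ t in 𝓝[≥] t₀, c₁ t ∈ φ.source ∧ c₂ t ∈ φ.source := by
    have h : ∀ᶠ t in 𝓝[Icc a b] t₀, c₁ t ∈ φ.source ∧ c₂ t ∈ φ.source :=
      ((h₁.1 t₀ ht₀').continuousWithinAt.eventually (φ.open_source.mem_nhds hs)).and
        ((h₂.1 t₀ ht₀').continuousWithinAt.eventually (φ.open_source.mem_nhds (h12 ▸ hs)))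
    exact h.filter_mono (nhdsWithin_le_iff.2 (Icc_mem_nhdsGE_of_mem ht₀))
  obtain ⟨t₃, ht₃, hin⟩ := (mem_nhdsGE_iff_exists_mem_Ioc_Ico_subset ht₀.2).1 hev
  obtain ⟨t₁, h01, h13⟩ := exists_between ht₃.1
  have hsub : Icc t₀ t₁ ⊆ Icc a b := Icc_subset_Icc ht₀.1 (h13.le.trans ht₃.2)
  have hsrc : ∀ t ∈ Icc t₀ t₁, c₁ t ∈ φ.source ∧ c₂ t ∈ φ.source := fun t ht =>
    hin ⟨ht.1, ht.2.trans_lt h13⟩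
  have hf := F.isLocalFinsler_inChart hφ
  suffices h : ∃ t₂ ∈ Ioc t₀ t₁, EqOn (fun r => φ (c₁ r)) (fun r => φ (c₂ r)) (Icc t₀ t₂) by
    obtain ⟨t₂, ht₂, heq⟩ := h
    refine ⟨t₂, ⟨ht₂.1, ht₂.2.trans (h13.le.trans ht₃.2)⟩, fun t ht => ?_⟩
    have ht' : t ∈ Icc t₀ t₁ := ⟨ht.1, ht.2.trans ht₂.2⟩
    exact φ.injOn (hsrc t ht').1 (hsrc t ht').2 (heq ht)
  -- At zero velocity the spray is unavailable. Constant speed makes both curves stationary instead.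
  by_cases hw : derivWithin (fun r => φ (c₁ r)) (Icc a b) t₀ = 0
  · have hconst : ∀ {c : ℝ → M}, F.IsGeodesic c a b → (∀ t ∈ Icc t₀ t₁, c t ∈ φ.source) →
        derivWithin (fun r => φ (c r)) (Icc a b) t₀ = 0 → ∀ t ∈ Icc t₀ t₁,
        φ (c t) = φ (c t₀) := by
      intro c hc hcs hc0
      have hspeed : ∀ t ∈ Icc t₀ t₁, F.inChart φ (φ (c t))
          (derivWithin (fun r => φ (c r)) (Icc a b) t) = 0 := by
        have hz := hf.map_zero (φ.map_source (hcs t₀ (left_mem_Icc.2 h01.le)))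
        rw [← hc0, F.inChart_derivWithin hφ (hc.mdifferentiableWithinAt ht₀')
          (uniqueDiffOn_Icc hab t₀ ht₀') (hcs t₀ (left_mem_Icc.2 h01.le)),
          hc.speed_eq hab ht₀'] at hz
        intro t ht
        rw [F.inChart_derivWithin hφ (hc.mdifferentiableWithinAt (hsub ht))
          (uniqueDiffOn_Icc hab t (hsub ht)) (hcs t ht), hc.speed_eq hab (hsub ht), hz]
      have hD : ∀ t ∈ Icc t₀ t₁, HasDerivWithinAt (fun r => φ (c r)) 0 (Icc a b) t := by
        intro t ht
        have h0 : derivWithin (fun r => φ (c r)) (Icc a b) t = 0 := by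
          by_contra hne
          exact (hf.pos _ (φ.map_source (hcs t ht)) _ hne).ne' (hspeed t ht)
        rw [← h0]
        exact (hc.solvesEulerLagrange hab hφ (hsub ht) (hcs t ht)).hasDerivWithinAt_position
      exact constant_of_has_deriv_right_zero
        (fun s hs => (hD s hs).continuousWithinAt.mono hsub)
        (fun s hs => (hD s (Ico_subset_Icc_self hs)).mono_of_mem_nhdsWithin
          (Icc_mem_nhdsGE_of_mem ⟨ht₀.1.trans hs.1, hs.2.trans_le (h13.le.trans ht₃.2)⟩))
    refine ⟨t₁, ⟨h01, le_rfl⟩, fun t ht => ?_⟩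
    simp only
    rw [hconst h₁ (fun t ht => (hsrc t ht).1) hw t ht,
      hconst h₂ (fun t ht => (hsrc t ht).2) (hd ▸ hw) t ht, h12]
  · exact hf.exists_eqOn_Icc_of_solves ht₀.1 h01 (h13.le.trans ht₃.2)
      (fun t ht => h₁.solvesEulerLagrange hab hφ (hsub ht) (hsrc t ht).1)
      (fun t ht => h₂.solvesEulerLagrange hab hφ (hsub ht) (hsrc t ht).2)
      (φ.map_source hs) hw (congrArg φ h12) hd

/-- A geodesic is determined by its initial velocity. -/
theorem IsGeodesic.eqOn_of_velocity_eq [T2Space M] {c₁ c₂ : ℝ → M} (h₁ : F.IsGeodesic c₁ a b)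
    (h₂ : F.IsGeodesic c₂ a b) (hab : a < b)
    (hv : velocity n c₁ a b a = velocity n c₂ a b a) : EqOn c₁ c₂ (Icc a b) := by
  have ha : a ∈ Icc a b := left_mem_Icc.2 hab.le
  have h0 : c₁ a = c₂ a := congrArg Bundle.TotalSpace.proj hv
  -- Continuous induction on [a,b]: T ∩ [a,b] is closed because M is Hausdorff, and agreement up to
  -- t < b extends beyond t by local uniqueness.
  set T : Set ℝ := {t | ∀ r ∈ Icc a b, r ≤ t → c₁ r = c₂ r} with hT
  have hclosed : IsClosed (T ∩ Icc a b) := by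
    rw [← isSeqClosed_iff_isClosed]
    intro x t hx hxt
    have htI : t ∈ Icc a b := isClosed_Icc.mem_of_tendsto hxt (Eventually.of_forall fun k => (hx k).2)
    have hlt : ∀ r ∈ Icc a b, r < t → c₁ r = c₂ r := by
      intro r hr hrt
      obtain ⟨k, hk⟩ := (hxt.eventually (lt_mem_nhds hrt)).exists
      exact (hx k).1 r hr hk.le
    refine ⟨fun r hr hrt => ?_, htI⟩
    rcases hrt.lt_or_eq with hrt | rfl
    · exact hlt r hr hrt
    · rcases hr.1.eq_or_lt with rfl | har
      · exact h0
      · have hne : (𝓝[Ico a r] r).NeBot := by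
          rw [nhdsWithin_Ico_eq_nhdsLT har]; infer_instance
        have hsub : Ico a r ⊆ Icc a b := fun s hs => ⟨hs.1, hs.2.le.trans hr.2⟩
        have l1 : Tendsto c₁ (𝓝[Ico a r] r) (𝓝 (c₁ r)) :=
          (h₁.1 r hr).continuousWithinAt.mono hsub
        have l2 : Tendsto c₂ (𝓝[Ico a r] r) (𝓝 (c₂ r)) :=
          (h₂.1 r hr).continuousWithinAt.mono hsub
        refine tendsto_nhds_unique_of_eventuallyEq l1 l2 ?_
        filter_upwards [self_mem_nhdsWithin] with s hs
        exact hlt s (hsub hs) hs.2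
  have key : Icc a b ⊆ T := by
    refine hclosed.Icc_subset_of_forall_exists_gt ?_ ?_
    · intro r hr hra
      rw [le_antisymm hra hr.1, h0]
    · rintro t ⟨htT, ht⟩ y hy
      have htI := Ico_subset_Icc_self ht
      have h12 : c₁ t = c₂ t := htT t htI le_rfl
      set φ := chartAt (EuclideanSpace ℝ (Fin n)) (c₁ t) with hφdef
      have hφ : φ ∈ IsManifold.maximalAtlas (𝓡 n) ∞ M :=
        IsManifold.chart_mem_maximalAtlas (c₁ t)
      have hs : c₁ t ∈ φ.source := mem_chart_source _ _
      have hd : derivWithin (fun r => φ (c₁ r)) (Icc a b) t =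
          derivWithin (fun r => φ (c₂ r)) (Icc a b) t := by
        -- At t = a the velocities agree by hypothesis. Later they are left derivatives of curves
        -- that agree on [a,t].
        rcases ht.1.eq_or_lt with rfl | hat
        · rw [derivWithin_chart_comp hφ (h₁.mdifferentiableWithinAt ha)
            (uniqueDiffOn_Icc hab a ha) hs, derivWithin_chart_comp hφ
            (h₂.mdifferentiableWithinAt ha) (uniqueDiffOn_Icc hab a ha) (h12 ▸ hs)]
          exact congrArg (fun v : TangentBundle (𝓡 n) M =>
            (mfderiv (𝓡 n) (𝓡 n) φ v.1 v.2 : EuclideanSpace ℝ (Fin n))) hv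
        · have hsub : Icc a t ⊆ Icc a b := Icc_subset_Icc le_rfl htI.2
          have hu := uniqueDiffOn_Icc hat t (right_mem_Icc.2 hat.le)
          rw [← derivWithin_subset hsub hu (h₁.solvesEulerLagrange hab hφ htI
            hs).hasDerivWithinAt_position.differentiableWithinAt,
            ← derivWithin_subset hsub hu (h₂.solvesEulerLagrange hab hφ htI
            (h12 ▸ hs)).hasDerivWithinAt_position.differentiableWithinAt]
          exact derivWithin_congr (fun r hr => by simp only [htT r (hsub hr) hr.2])
            (by simp only [h12])
      obtain ⟨t₂, ht₂, heq⟩ := h₁.exists_eqOn_of_derivWithin_eq h₂ ht hφ hs h12 hd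
      refine ⟨min t₂ y, fun r hr hrt => ?_, lt_min ht₂.1 hy, min_le_right _ _⟩
      by_cases hrt' : r ≤ t
      · exact htT r hr hrt'
      · exact heq ⟨(not_le.1 hrt').le, hrt.trans (min_le_left _ _)⟩
  exact fun t ht => key ht t ht le_rfl

end FinslerMetric

/-! ### Affine reparametrization and the exponential mapping. -/

namespace FinslerMetric

variable {n : ℕ} {M : Type*} [TopologicalSpace M] [ChartedSpace (EuclideanSpace ℝ (Fin n)) M]
  [IsManifold (𝓡 n) ∞ M] {φ : OpenPartialHomeomorph M (EuclideanSpace ℝ (Fin n))}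
  {F : FinslerMetric n M} {c : ℝ → M} {a b : ℝ}

theorem sqInChart_smul (F : FinslerMetric n M) (hφ : φ ∈ IsManifold.maximalAtlas (𝓡 n) ∞ M)
    {u : EuclideanSpace ℝ (Fin n)} (hu : u ∈ φ.target) (w : EuclideanSpace ℝ (Fin n)) {k : ℝ}
    (hk : 0 ≤ k) : F.sqInChart φ u (k • w) = k ^ 2 * F.sqInChart φ u w := by
  rw [sqInChart_eq, sqInChart_eq, (F.isLocalFinsler_inChart hφ).homog u hu w k hk, mul_pow]

/-- F² is homogeneous of degree 2, so its fibre derivative has degree 1 and its base derivative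
degree 2. Under t = a + k s both sides of the Euler-Lagrange equations therefore scale by k², the
left one with a factor k from d/ds. -/
theorem fderiv_sqInChart_fiber_smul (F : FinslerMetric n M)
    (hφ : φ ∈ IsManifold.maximalAtlas (𝓡 n) ∞ M) {u : EuclideanSpace ℝ (Fin n)}
    (hu : u ∈ φ.target) (w e : EuclideanSpace ℝ (Fin n)) {k : ℝ} (hk : 0 < k) :
    fderiv ℝ (fun w => F.sqInChart φ u w) (k • w) e =
      k * fderiv ℝ (fun w => F.sqInChart φ u w) w e := by
  have h1 : fderiv ℝ (fun w => F.sqInChart φ u (k • w)) w =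
      k • fderiv ℝ (fun w => F.sqInChart φ u w) (k • w) :=
    fderiv_comp_smul (f := fun w => F.sqInChart φ u w) (x := w) k
  have h2 : (fun w => F.sqInChart φ u (k • w)) = k ^ 2 • fun w => F.sqInChart φ u w := by
    funext w
    rw [F.sqInChart_smul hφ hu w hk.le, Pi.smul_apply, smul_eq_mul]
  rw [h2, fderiv_const_smul_field] at h1
  have h3 := congrArg (fun T => T e) h1
  simp only [Pi.smul_apply, _root_.smul_apply, smul_eq_mul] at h3
  exact mul_left_cancel₀ hk.ne' (by rw [← h3]; ring)

theorem fderiv_sqInChart_base_smul (F : FinslerMetric n M)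
    (hφ : φ ∈ IsManifold.maximalAtlas (𝓡 n) ∞ M) {u : EuclideanSpace ℝ (Fin n)}
    (hu : u ∈ φ.target) (w e : EuclideanSpace ℝ (Fin n)) {k : ℝ} (hk : 0 < k) :
    fderiv ℝ (fun u => F.sqInChart φ u (k • w)) u e =
      k ^ 2 * fderiv ℝ (fun u => F.sqInChart φ u w) u e := by
  have h : (fun u => F.sqInChart φ u (k • w)) =ᶠ[𝓝 u] k ^ 2 • fun u => F.sqInChart φ u w := by
    filter_upwards [φ.open_target.mem_nhds hu] with x hx
    rw [F.sqInChart_smul hφ hx w hk.le, Pi.smul_apply, smul_eq_mul]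
  rw [h.fderiv_eq, fderiv_const_smul_field]
  simp

/-- The momentum of a constant curve does not depend on time, and F² vanishes on the zero section,
so the force is zero. This yields Exp_y(0) = y. -/
theorem isGeodesic_const (F : FinslerMetric n M) (y : M) (a b : ℝ) :
    F.IsGeodesic (fun _ => y) a b := by
  refine ⟨contMDiffOn_const, fun φ hφ t ht hs e => ?_⟩
  have h0 : ∀ u, F.sqInChart φ u 0 = 0 := by
    intro u
    rw [sqInChart_eq, inChart, _root_.map_zero]
    exact (congrArg (· ^ 2) (F.map_zero (φ.symm u))).trans (by simp)
  simp only [derivWithin_fun_const, Pi.zero_apply, h0, fderiv_fun_const]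
  exact hasDerivWithinAt_const _ _ _

/-- The derivative of a curve, as a vector of the model space. -/
noncomputable def curveDeriv (n : ℕ) {M : Type*} [TopologicalSpace M]
    [ChartedSpace (EuclideanSpace ℝ (Fin n)) M] (c : ℝ → M) (S : Set ℝ) (t : ℝ) :
    EuclideanSpace ℝ (Fin n) :=
  mfderivWithin 𝓘(ℝ, ℝ) (𝓡 n) c S t (1 : ℝ)

theorem mapsTo_affine {k : ℝ} (hk : 0 ≤ k) (hkb : a + k ≤ b) :
    MapsTo (fun s : ℝ => a + k * s) (Icc 0 1) (Icc a b) := by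
  intro s hs
  constructor
  · have := mul_nonneg hk hs.1
    simp only
    linarith
  · have := mul_le_mul_of_nonneg_left hs.2 hk
    simp only
    linarith

theorem hasDerivWithinAt_affine (k a s : ℝ) (S : Set ℝ) :
    HasDerivWithinAt (fun s : ℝ => a + k * s) k S s := by
  simpa using (((hasDerivWithinAt_id s S).const_mul k).const_add a :)

/-- Affine reparametrizations of geodesics are geodesics. -/
theorem IsGeodesic.comp_affine (hc : F.IsGeodesic c a b) {k : ℝ} (hk : 0 < k)
    (hkb : a + k ≤ b) : F.IsGeodesic (fun s => c (a + k * s)) 0 1 := by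
  have hmaps := mapsTo_affine hk.le hkb
  have hab : a < b := by linarith
  refine ⟨?_, fun φ hφ t ht hs e => ?_⟩
  · have h1 : ContMDiff 𝓘(ℝ, ℝ) 𝓘(ℝ, ℝ) 2 (fun s : ℝ => a + k * s) := by
      rw [contMDiff_iff_contDiff]; fun_prop
    exact hc.1.comp h1.contMDiffOn hmaps
  have hd : ∀ r ∈ Icc (0 : ℝ) 1, c (a + k * r) ∈ φ.source →
      derivWithin (fun r => φ (c (a + k * r))) (Icc 0 1) r =
        k • derivWithin (fun r => φ (c r)) (Icc a b) (a + k * r) := fun r hr hcr =>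
    (HasDerivWithinAt.scomp (h := fun s => a + k * s) r
      (hc.solvesEulerLagrange hab hφ (hmaps hr) hcr).hasDerivWithinAt_position
      (hasDerivWithinAt_affine k a r _) hmaps).derivWithin (uniqueDiffOn_Icc zero_lt_one r hr)
  have h1 := (HasDerivWithinAt.scomp (h := fun s => a + k * s) t (hc.2 φ hφ _ (hmaps ht) hs e)
    (hasDerivWithinAt_affine k a t _) hmaps).const_mul k
  have h2 : ∀ r ∈ Icc (0 : ℝ) 1, c (a + k * r) ∈ φ.source →
      fderiv ℝ (fun w => F.sqInChart φ (φ (c (a + k * r))) w)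
        (derivWithin (fun r => φ (c (a + k * r))) (Icc 0 1) r) e =
      k * fderiv ℝ (fun w => F.sqInChart φ (φ (c (a + k * r))) w)
        (derivWithin (fun r => φ (c r)) (Icc a b) (a + k * r)) e := fun r hr hcr => by
    rw [hd r hr hcr, F.fderiv_sqInChart_fiber_smul hφ (φ.map_source hcr) _ _ hk]
  refine (h1.congr_of_eventuallyEq ?_ (h2 t ht hs)).congr_deriv ?_
  · have hcont : ContinuousWithinAt (fun r => c (a + k * r)) (Icc 0 1) t :=
      (hc.1 _ (hmaps ht)).continuousWithinAt.comp (f := fun r : ℝ => a + k * r)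
        (hasDerivWithinAt_affine k a t _).continuousWithinAt hmaps
    filter_upwards [self_mem_nhdsWithin, hcont.eventually (φ.open_source.mem_nhds hs)]
      with r hr hcr
    exact h2 r hr hcr
  · rw [hd t ht hs, F.fderiv_sqInChart_base_smul hφ (φ.map_source hs) _ _ hk, smul_eq_mul]
    ring

theorem velocity_comp_affine (hc : F.IsGeodesic c a b) {k : ℝ} (hk : 0 < k)
    (hkb : a + k ≤ b) : velocity n (fun s => c (a + k * s)) 0 1 0 =
      ⟨c a, k • curveDeriv n c (Icc a b) a⟩ := by
  let T : ℝ →L[ℝ] EuclideanSpace ℝ (Fin n) := mfderivWithin 𝓘(ℝ, ℝ) (𝓡 n) c (Icc a b) a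
  have hA : HasMFDerivWithinAt 𝓘(ℝ, ℝ) 𝓘(ℝ, ℝ) (fun s : ℝ => a + k * s) (Icc 0 1) 0
      (ContinuousLinearMap.toSpanSingleton ℝ k) :=
    (hasDerivWithinAt_affine k a 0 _).hasFDerivWithinAt.hasMFDerivWithinAt
  have hC : ∀ p : ℝ, p = a → HasMFDerivWithinAt 𝓘(ℝ, ℝ) (𝓡 n) c (Icc a b) p T := by
    rintro p rfl
    exact (hc.mdifferentiableWithinAt (left_mem_Icc.2 (by linarith))).hasMFDerivWithinAt
  have h := (HasMFDerivWithinAt.comp (f := fun s : ℝ => a + k * s) (0 : ℝ)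
    (hC (a + k * 0) (by ring)) hA (mapsTo_affine hk.le hkb)).mfderivWithin
    (uniqueDiffOn_Icc zero_lt_one _ (left_mem_Icc.2 zero_le_one)).uniqueMDiffWithinAt
  have hk1 : curveDeriv n (fun s => c (a + k * s)) (Icc 0 1) 0 =
      (T.comp (ContinuousLinearMap.toSpanSingleton ℝ k)) 1 :=
    congrArg (fun T : ℝ →L[ℝ] EuclideanSpace ℝ (Fin n) => T 1) h
  have hk2 : (T.comp (ContinuousLinearMap.toSpanSingleton ℝ k)) 1 =
      k • curveDeriv n c (Icc a b) a := by
    have : T k = k • T 1 := by rw [← map_smul, smul_eq_mul, mul_one]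
    have hT : T 1 = curveDeriv n c (Icc a b) a := rfl
    rw [← hT, ← this]
    simp
  exact tangentBundle_mk_congr (by simp) (hk1.trans hk2)

theorem velocity_const {n : ℕ} {M : Type*} [TopologicalSpace M]
    [ChartedSpace (EuclideanSpace ℝ (Fin n)) M] (y : M) (a b t : ℝ) :
    velocity n (fun _ => y) a b t = ⟨y, (0 : EuclideanSpace ℝ (Fin n))⟩ := by
  unfold velocity
  rw [mfderivWithin_const]
  rfl

/-- By uniqueness the endpoint chosen in the definition of `exp` is that of every geodesic with this
initial velocity. -/
theorem IsGeodesic.exp_velocity [T2Space M] (hc : F.IsGeodesic c 0 1) :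
    F.exp (velocity n c 0 1 0) = c 1 := by
  have h : ∃ z, F.ExpRel (velocity n c 0 1 0) z := ⟨c 1, c, hc, rfl, rfl⟩
  unfold exp
  rw [dif_pos h]
  obtain ⟨c', hc', hv, h1⟩ := h.choose_spec
  rw [← h1]
  exact hc'.eqOn_of_velocity_eq hc zero_lt_one hv (right_mem_Icc.2 zero_le_one)

theorem expAt_zero [T2Space M] (F : FinslerMetric n M) (y : M) : F.expAt y 0 = y := by
  have h := (F.isGeodesic_const y 0 1).exp_velocity
  rw [velocity_const] at h
  exact h

/-- The exponential mapping takes rays to geodesics. -/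
theorem IsGeodesic.expAt_smul [T2Space M] (hc : F.IsGeodesic c a b) {k : ℝ} (hk : 0 ≤ k)
    (hkb : a + k ≤ b) : F.expAt (c a) (k • curveDeriv n c (Icc a b) a) = c (a + k) := by
  rcases hk.eq_or_lt with rfl | hk
  · rw [add_zero, zero_smul, expAt_zero]
  · have h := (hc.comp_affine hk hkb).exp_velocity
    rw [velocity_comp_affine hc hk hkb, mul_one] at h
    exact h

/-- Smoothness is assumed off the zero section only; continuity across it comes from the homogeneous
bound in a chart. -/
theorem continuous_toFun (F : FinslerMetric n M) : Continuous F.toFun := by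
  rw [continuous_iff_continuousAt]
  intro v
  set φ := chartAt (EuclideanSpace ℝ (Fin n)) v.1 with hφdef
  have hφ : φ ∈ IsManifold.maximalAtlas (𝓡 n) ∞ M := IsManifold.chart_mem_maximalAtlas v.1
  have hv : v.1 ∈ φ.source := mem_chart_source _ _
  have hopen : IsOpen (Bundle.TotalSpace.proj ⁻¹' φ.source : Set (TangentBundle (𝓡 n) M)) :=
    φ.open_source.preimage (FiberBundle.continuous_proj _ _)
  have h1 : ContinuousOn (tangentMapWithin (𝓡 n) (𝓡 n) φ φ.source)
      (Bundle.TotalSpace.proj ⁻¹' φ.source) :=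
    (contMDiffOn_of_mem_maximalAtlas hφ).continuousOn_tangentMapWithin (by simp)
      φ.open_source.uniqueMDiffOn
  have h2 : ContinuousAt (fun v' : TangentBundle (𝓡 n) M =>
      tangentBundleModelSpaceHomeomorph (𝓡 n) (tangentMapWithin (𝓡 n) (𝓡 n) φ φ.source v')) v :=
    (tangentBundleModelSpaceHomeomorph (𝓡 n)).continuous.continuousAt.comp
      (h1.continuousAt (hopen.mem_nhds hv))
  have h3 : ContinuousAt (fun v' : TangentBundle (𝓡 n) M => (F.inChart φ (φ v'.1)
      (mfderivWithin (𝓡 n) (𝓡 n) φ φ.source v'.1 v'.2))) v :=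
    ContinuousAt.comp (f := fun v' : TangentBundle (𝓡 n) M =>
      (tangentBundleModelSpaceHomeomorph (𝓡 n) (tangentMapWithin (𝓡 n) (𝓡 n) φ φ.source v') :
        EuclideanSpace ℝ (Fin n) × EuclideanSpace ℝ (Fin n)))
      ((F.isLocalFinsler_inChart hφ).continuousAt (φ.map_source hv)) h2
  refine h3.congr ?_
  filter_upwards [hopen.mem_nhds hv] with v' hv'
  have hv'' : v'.1 ∈ φ.source := hv'
  rw [mfderivWithin_of_isOpen φ.open_source hv'']
  have h := congrArg (fun T => T v'.2)
    ((mdifferentiable_of_mem_maximalAtlas hφ).symm_comp_deriv hv'')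
  have h' : symmDeriv φ (φ v'.1) (mfderiv (𝓡 n) (𝓡 n) φ v'.1 v'.2) = v'.2 := h
  unfold inChart
  rw [h']
  exact congrArg F.toFun (tangentBundle_mk_congr (φ.left_inv hv'') rfl)

end FinslerMetric

/-! ### Normal balls and the Gauss lemma on the manifold. -/

namespace FinslerMetric

variable {n : ℕ} {M : Type*} [TopologicalSpace M] [ChartedSpace (EuclideanSpace ℝ (Fin n)) M]
  [IsManifold (𝓡 n) ∞ M] {φ : OpenPartialHomeomorph M (EuclideanSpace ℝ (Fin n))}
  {F : FinslerMetric n M} {y : M} {η : ℝ}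

/-- The restriction of `F` to the tangent space at `y`, identified with the model space. -/
noncomputable def fiber (F : FinslerMetric n M) (y : M) (X : EuclideanSpace ℝ (Fin n)) : ℝ :=
  F.toFun ⟨y, X⟩

theorem fiber_nonneg (F : FinslerMetric n M) (y : M) (X : EuclideanSpace ℝ (Fin n)) :
    0 ≤ F.fiber y X := F.nonneg _

theorem fiber_zero (F : FinslerMetric n M) (y : M) : F.fiber y 0 = 0 := F.map_zero y

theorem fiber_pos (F : FinslerMetric n M) (y : M) {X : EuclideanSpace ℝ (Fin n)} (hX : X ≠ 0) :
    0 < F.fiber y X := F.pos y X hX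

theorem fiber_smul (F : FinslerMetric n M) (y : M) (X : EuclideanSpace ℝ (Fin n)) {r : ℝ}
    (hr : 0 ≤ r) : F.fiber y (r • X) = r * F.fiber y X := F.homogeneous y X r hr

theorem mem_tangentBall {X : EuclideanSpace ℝ (Fin n)} :
    X ∈ F.tangentBall y η ↔ F.fiber y X < η := Iff.rfl

theorem continuous_fiber (F : FinslerMetric n M) (y : M) : Continuous (F.fiber y) :=
  F.continuous_toFun.comp (FiberBundle.continuous_totalSpaceMk (EuclideanSpace ℝ (Fin n))
    (fun x : M => TangentSpace (𝓡 n) x) y)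

theorem differentiableAt_fiber (F : FinslerMetric n M) (y : M) {X : EuclideanSpace ℝ (Fin n)}
    (hX : X ≠ 0) : DifferentiableAt ℝ (F.fiber y) X := by
  set φ := chartAt (EuclideanSpace ℝ (Fin n)) y with hφdef
  have hφ : φ ∈ IsManifold.maximalAtlas (𝓡 n) ∞ M := IsManifold.chart_mem_maximalAtlas y
  have hy : y ∈ φ.source := mem_chart_source _ _
  let A : EuclideanSpace ℝ (Fin n) →L[ℝ] EuclideanSpace ℝ (Fin n) := mfderiv (𝓡 n) (𝓡 n) φ y
  have hA : ∀ Y, symmDeriv φ (φ y) (A Y) = Y := fun Y =>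
    congrArg (fun T : EuclideanSpace ℝ (Fin n) →L[ℝ] EuclideanSpace ℝ (Fin n) => T Y)
      ((mdifferentiable_of_mem_maximalAtlas hφ).symm_comp_deriv hy)
  have hAX : A X ≠ 0 := by
    intro h0
    have := hA X
    rw [h0, _root_.map_zero] at this
    exact hX this.symm
  have heq : F.fiber y = F.inChart φ (φ y) ∘ A := by
    funext Y
    simp only [Function.comp, inChart, hA]
    exact congrArg F.toFun (tangentBundle_mk_congr (φ.left_inv hy) rfl).symm
  rw [heq]
  exact ((F.isLocalFinsler_inChart hφ).differentiableAt_fiber (φ.map_source hy) hAX).comp X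
    A.differentiableAt

theorem isOpen_tangentBall (F : FinslerMetric n M) (y : M) (η : ℝ) : IsOpen (F.tangentBall y η) :=
  isOpen_lt (F.continuous_fiber y) continuous_const

theorem zero_mem_tangentBall (hη : 0 < η) : (0 : EuclideanSpace ℝ (Fin n)) ∈ F.tangentBall y η := by
  rw [mem_tangentBall, fiber_zero]; exact hη

theorem smul_mem_tangentBall {X : EuclideanSpace ℝ (Fin n)} (hX : X ∈ F.tangentBall y η) {t : ℝ}
    (h0 : 0 ≤ t) (h1 : t ≤ 1) : t • X ∈ F.tangentBall y η := by
  rw [mem_tangentBall] at *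
  rw [F.fiber_smul y X h0]
  exact (mul_le_of_le_one_left (F.fiber_nonneg y X) h1).trans_lt hX

/-- A positive lower bound m of F on the unit sphere gives m‖X‖ ≤ F(y,X), so the sublevel set is
bounded. -/
theorem isCompact_fiber_le (F : FinslerMetric n M) (y : M) (r : ℝ) :
    IsCompact {X | F.fiber y X ≤ r} := by
  obtain ⟨m, hm, hS⟩ := (isCompact_sphere (0 : EuclideanSpace ℝ (Fin n)) 1).exists_forall_le'
    (F.continuous_fiber y).continuousOn (a := 0) (fun X hX => F.fiber_pos y (by
      rintro rfl; simp at hX))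
  refine (isCompact_closedBall (0 : EuclideanSpace ℝ (Fin n)) (r / m)).of_isClosed_subset
    (isClosed_le (F.continuous_fiber y) continuous_const) ?_
  intro X hX
  rw [mem_closedBall_zero_iff, le_div_iff₀ hm]
  refine le_trans ?_ hX
  by_cases hX0 : X = 0
  · simp [hX0, fiber_zero]
  have hn : 0 < ‖X‖ := norm_pos_iff.2 hX0
  have h1 : F.fiber y X = ‖X‖ * F.fiber y (‖X‖⁻¹ • X) := by
    rw [← F.fiber_smul y _ hn.le, smul_smul, mul_inv_cancel₀ hn.ne', one_smul]
  rw [h1]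
  exact mul_le_mul_of_nonneg_left (hS _ (by simp [norm_smul, hn.ne'])) hn.le

/-- The geodesic with initial velocity `X` is the image of a ray. -/
theorem IsExpDiffeo.exists_geodesic [T2Space M] (h : F.IsExpDiffeo y η)
    {X : EuclideanSpace ℝ (Fin n)} (hX : X ∈ F.tangentBall y η) :
    ∃ c : ℝ → M, F.IsGeodesic c 0 1 ∧ velocity n c 0 1 0 = ⟨y, X⟩ ∧
      ∀ t ∈ Icc (0 : ℝ) 1, c t = F.expAt y (t • X) := by
  obtain ⟨z, c, hc, hv, -⟩ := h.defined X hX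
  refine ⟨c, hc, hv, fun t ht => ?_⟩
  have h1 := hc.expAt_smul ht.1 (by rw [zero_add]; exact ht.2)
  rw [zero_add] at h1
  rw [← h1]
  exact congrArg (fun v : TangentBundle (𝓡 n) M => F.exp ⟨v.1, t • v.2⟩) hv

/-- The inverse of the exponential mapping is a chart of the punctured ball. -/
theorem IsExpDiffeo.exists_chart [T2Space M] (h : F.IsExpDiffeo y η) (hη : 0 < η)
    {L : M → EuclideanSpace ℝ (Fin n)} (hL : LeftInvOn L (F.expAt y) (F.tangentBall y η))
    (hLs : ContMDiffOn (𝓡 n) (𝓡 n) ∞ L (F.expAt y '' (F.tangentBall y η \ {0}))) :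
    ∃ φ : OpenPartialHomeomorph M (EuclideanSpace ℝ (Fin n)),
      φ ∈ IsManifold.maximalAtlas (𝓡 n) ∞ M ∧
      φ.source = F.expAt y '' (F.tangentBall y η \ {0}) ∧ φ.target = F.tangentBall y η \ {0} ∧
      ⇑φ = L ∧ ⇑φ.symm = F.expAt y := by
  have hinj : InjOn (F.expAt y) (F.tangentBall y η) := hL.injOn
  -- The centre is removed because Exp_y and its inverse are only C¹ there, which is not enough for
  -- a chart of the smooth structure.
  have hopen : IsOpen (F.expAt y '' (F.tangentBall y η \ {0})) := by
    rw [hinj.image_sdiff_subset (singleton_subset_iff.2 (zero_mem_tangentBall hη)),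
      image_singleton]
    exact h.isOpen_expBall.sdiff isClosed_singleton
  let φ : OpenPartialHomeomorph M (EuclideanSpace ℝ (Fin n)) :=
    { toFun := L
      invFun := F.expAt y
      source := F.expAt y '' (F.tangentBall y η \ {0})
      target := F.tangentBall y η \ {0}
      map_source' := by
        rintro _ ⟨X, hX, rfl⟩
        rwa [hL hX.1]
      map_target' := fun X hX => mem_image_of_mem _ hX
      left_inv' := by
        rintro _ ⟨X, hX, rfl⟩
        rw [hL hX.1]
      right_inv' := fun X hX => hL hX.1
      open_source := hopen
      open_target := (F.isOpen_tangentBall y η).sdiff isClosed_singleton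
      continuousOn_toFun := hLs.continuousOn
      continuousOn_invFun := h.contMDiffOn_infty.continuousOn }
  exact ⟨φ, φ.mem_maximalAtlas_of_contMDiffOn hLs h.contMDiffOn_infty, rfl, rfl, rfl, rfl⟩

/-- The Gauss lemma, combined with the fundamental inequality. -/
theorem IsExpDiffeo.fderiv_fiber_le [T2Space M] (h : F.IsExpDiffeo y η) (hη : 0 < η)
    (hφ : φ ∈ IsManifold.maximalAtlas (𝓡 n) ∞ M)
    (htgt : φ.target = F.tangentBall y η \ {0})
    (hsymm : ⇑φ.symm = F.expAt y) {X : EuclideanSpace ℝ (Fin n)} (hX : X ∈ φ.target)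
    (e : EuclideanSpace ℝ (Fin n)) : fderiv ℝ (F.fiber y) X e ≤ F.inChart φ X e := by
  have hf := F.isLocalFinsler_inChart hφ
  have hX' : X ∈ F.tangentBall y η \ {0} := htgt ▸ hX
  have hsm : ∀ t ∈ Ioc (0 : ℝ) 1, ∀ Y ∈ φ.target, t • Y ∈ φ.target := by
    intro t ht Y hY
    rw [htgt] at *
    exact ⟨smul_mem_tangentBall hY.1 ht.1.le ht.2, smul_ne_zero ht.1.ne' hY.2⟩
  -- In this chart the geodesics issuing from y are the rays t ↦ tY, with constant coordinate
  -- velocity Y.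
  have hray : ∀ Y ∈ φ.target, ∃ c : ℝ → M, F.IsGeodesic c 0 1 ∧
      velocity n c 0 1 0 = ⟨y, Y⟩ ∧ (∀ t ∈ Ioc (0 : ℝ) 1, c t ∈ φ.source) ∧
      (∀ t ∈ Ioc (0 : ℝ) 1, φ (c t) = t • Y) ∧
      ∀ t ∈ Ioc (0 : ℝ) 1, derivWithin (fun r => φ (c r)) (Icc 0 1) t = Y := by
    intro Y hY
    obtain ⟨c, hc, hv, hct⟩ := h.exists_geodesic (htgt ▸ hY : Y ∈ F.tangentBall y η \ {0}).1
    have hpos : ∀ t ∈ Ioc (0 : ℝ) 1, φ (c t) = t • Y := by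
      intro t ht
      rw [hct t (Ioc_subset_Icc_self ht), ← hsymm, φ.right_inv (hsm t ht Y hY)]
    refine ⟨c, hc, hv, ?_, hpos, ?_⟩
    · intro t ht
      rw [hct t (Ioc_subset_Icc_self ht), ← hsymm]
      exact φ.map_target (hsm t ht Y hY)
    · intro t ht
      have hd : HasDerivWithinAt (fun r : ℝ => r • Y) Y (Icc 0 1) t := by
        simpa using (hasDerivWithinAt_id t (Icc (0 : ℝ) 1)).smul_const Y
      refine (hd.congr_of_eventuallyEq ?_ (hpos t ht)).derivWithin
        (uniqueDiffOn_Icc zero_lt_one t (Ioc_subset_Icc_self ht))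
      filter_upwards [self_mem_nhdsWithin, mem_nhdsWithin_of_mem_nhds (Ioi_mem_nhds ht.1)]
        with r hr hr0
      exact hpos r ⟨hr0, hr.2⟩
  have hnear : ∀ᶠ Y in 𝓝 X, Y ∈ φ.target := φ.open_target.mem_nhds hX
  rw [hf.fderiv_eq_of_rays hX hX'.2 (ρ := F.fiber y)]
  · exact hf.fderiv_fiber_le hX hX'.2 e
  · intro t ht
    filter_upwards [hnear] with Y hY using hsm t ht Y hY
  · intro t ht
    filter_upwards [hnear] with Y hY
    obtain ⟨c, hc, hv, hcs, hpos, hder⟩ := hray Y hY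
    have ht' := Ioc_subset_Icc_self ht
    have h1 := F.inChart_derivWithin hφ (hc.mdifferentiableWithinAt ht')
      (uniqueDiffOn_Icc zero_lt_one t ht') (hcs t ht)
    rw [hder t ht, hpos t ht, hc.speed_eq zero_lt_one ht', hv] at h1
    exact h1
  · exact F.differentiableAt_fiber y hX'.2
  · intro t ht e
    obtain ⟨c, hc, hv, hcs, hpos, hder⟩ := hray X hX
    have ht' := Ioc_subset_Icc_self ht
    have h1 := (hc.solvesEulerLagrange zero_lt_one hφ ht' (hcs t ht)).euler_lagrange e
    rw [hder t ht, hpos t ht] at h1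
    refine h1.congr_of_eventuallyEq ?_ (by rw [hder t ht, hpos t ht])
    filter_upwards [self_mem_nhdsWithin, mem_nhdsWithin_of_mem_nhds (Ioi_mem_nhds ht.1)]
      with r hr hr0
    rw [hder r ⟨hr0, hr.2⟩, hpos r ⟨hr0, hr.2⟩]
  -- F(dExp_y(tX) e) is continuous at t = 0 since Exp_y is C¹ on the whole ball, centre included;
  -- hence it is at most its value at 0 plus 1 for small t.
  · intro e
    have hB : IsOpen (F.tangentBall y η) := F.isOpen_tangentBall y η
    have h0 : (0 : EuclideanSpace ℝ (Fin n)) ∈ F.tangentBall y η := zero_mem_tangentBall hη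
    have h1 : ContinuousOn (tangentMapWithin (𝓡 n) (𝓡 n) (F.expAt y) (F.tangentBall y η))
        (Bundle.TotalSpace.proj ⁻¹' F.tangentBall y η) :=
      h.contMDiffOn_one.continuousOn_tangentMapWithin le_rfl hB.uniqueMDiffOn
    have h2 : Continuous fun t : ℝ => (tangentBundleModelSpaceHomeomorph (𝓡 n)).symm (t • X, e) := by
      refine (tangentBundleModelSpaceHomeomorph (𝓡 n)).symm.continuous.comp ?_
      exact (continuous_id.smul continuous_const).prodMk continuous_const
    let g : ℝ → ℝ := fun t => F.toFun (tangentMapWithin (𝓡 n) (𝓡 n) (F.expAt y)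
      (F.tangentBall y η) ((tangentBundleModelSpaceHomeomorph (𝓡 n)).symm (t • X, e)))
    have h3 : ContinuousAt g 0 := by
      refine F.continuous_toFun.continuousAt.comp (ContinuousAt.comp
        (g := tangentMapWithin (𝓡 n) (𝓡 n) (F.expAt y) (F.tangentBall y η)) (f := fun t : ℝ =>
        (tangentBundleModelSpaceHomeomorph (𝓡 n)).symm (t • X, e)) ?_ h2.continuousAt)
      refine h1.continuousAt ((hB.preimage (FiberBundle.continuous_proj _ _)).mem_nhds ?_)
      change (0 : ℝ) • X ∈ F.tangentBall y η
      rwa [zero_smul]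
    refine ⟨g 0 + 1, ?_⟩
    filter_upwards [mem_nhdsWithin_of_mem_nhds (h3.eventually (gt_mem_nhds (lt_add_one (g 0)))),
      Ioc_mem_nhdsGT (zero_lt_one' ℝ)] with t hlt ht
    refine le_of_eq_of_le ?_ (le_of_lt hlt)
    have hmem := hsm t ht X hX
    rw [htgt] at hmem
    have h4 : mfderivWithin (𝓡 n) (𝓡 n) (F.expAt y) (F.tangentBall y η) (t • X) =
        mfderiv (𝓡 n) (𝓡 n) (F.expAt y) (t • X) := mfderivWithin_of_isOpen hB hmem.1
    have h5 : tangentMapWithin (𝓡 n) (𝓡 n) (F.expAt y) (F.tangentBall y η)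
        ((tangentBundleModelSpaceHomeomorph (𝓡 n)).symm (t • X, e)) =
        ⟨F.expAt y (t • X), mfderiv (𝓡 n) (𝓡 n) (F.expAt y) (t • X) e⟩ := by
      rw [← h4]; rfl
    have h6 : ∀ ψ : EuclideanSpace ℝ (Fin n) → M, ψ = F.expAt y →
        F.toFun ⟨ψ (t • X), mfderiv (𝓡 n) (𝓡 n) ψ (t • X) e⟩ =
        F.toFun ⟨F.expAt y (t • X), mfderiv (𝓡 n) (𝓡 n) (F.expAt y) (t • X) e⟩ := by
      rintro _ rfl
      rfl
    simp only [g, h5]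
    exact h6 _ hsymm

end FinslerMetric

/-! ### Truncated distance and comparison of lengths. -/

/-- A function with values in `[0, r]` whose derivative is bounded by `f` wherever its value is
strictly between `0` and `r` increases by at most the integral of `f`. -/
theorem sub_le_integral_of_hasDerivAt_of_mem_Ioo {g g' f : ℝ → ℝ} {p q r : ℝ} (hpq : p ≤ q)
    (hg : ContinuousOn g (Icc p q)) (hg0 : ∀ t ∈ Icc p q, 0 ≤ g t ∧ g t ≤ r)
    (hd : ∀ t ∈ Ioo p q, 0 < g t → g t < r → HasDerivAt g (g' t) t ∧ g' t ≤ f t)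
    (hf : IntervalIntegrable f MeasureTheory.volume p q) (hf0 : ∀ t ∈ Icc p q, 0 ≤ f t) :
    g q - g p ≤ ∫ t in p..q, f t := by
  have hfint : 0 ≤ ∫ t in p..q, f t := intervalIntegral.integral_nonneg hpq hf0
  by_cases hlt : g q ≤ g p
  · linarith
  rw [not_le] at hlt
  have hpI : p ∈ Icc p q := left_mem_Icc.2 hpq
  have hqI : q ∈ Icc p q := right_mem_Icc.2 hpq
  -- t₂ is the first time g reaches g(q), and t₁ the last time before t₂ with g ≤ g(p). In between g
  -- lies strictly between g(p) and g(q), hence inside (0, r), where the derivative bound holds.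
  obtain ⟨t₂, ⟨ht₂, hgt₂⟩, hmin⟩ := (isCompact_Icc.of_isClosed_subset
    (hg.preimage_isClosed_of_isClosed isClosed_Icc isClosed_Ici)
    inter_subset_left).exists_isLeast (s := Icc p q ∩ g ⁻¹' Ici (g q)) ⟨q, hqI, le_refl (g q)⟩
  have hg2 : ContinuousOn g (Icc p t₂) := hg.mono (Icc_subset_Icc le_rfl ht₂.2)
  have hpt₂ : p ∈ Icc p t₂ := left_mem_Icc.2 ht₂.1
  obtain ⟨t₁, ⟨ht₁, hgt₁⟩, hmax⟩ := (isCompact_Icc.of_isClosed_subset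
    (hg2.preimage_isClosed_of_isClosed isClosed_Icc isClosed_Iic)
    inter_subset_left).exists_isGreatest (s := Icc p t₂ ∩ g ⁻¹' Iic (g p)) ⟨p, hpt₂, le_refl (g p)⟩
  simp only [mem_preimage, mem_Ici, mem_Iic] at hgt₂ hgt₁
  have hsub : Icc t₁ t₂ ⊆ Icc p q := Icc_subset_Icc ht₁.1 ht₂.2
  have hbet : ∀ t ∈ Ioo t₁ t₂, g p < g t ∧ g t < g q := by
    intro t ht
    constructor
    · by_contra hc
      exact not_le.2 ht.1 (hmax ⟨⟨ht₁.1.trans ht.1.le, ht.2.le⟩, not_lt.1 hc⟩)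
    · by_contra hc
      exact not_le.2 ht.2 (hmin ⟨⟨ht₁.1.trans ht.1.le, ht.2.le.trans ht₂.2⟩, not_lt.1 hc⟩)
  have hD : ∀ t ∈ Ioo t₁ t₂, HasDerivAt g (g' t) t ∧ g' t ≤ f t := fun t ht =>
    hd t ⟨ht₁.1.trans_lt ht.1, ht.2.trans_le ht₂.2⟩
      ((hg0 p hpI).1.trans_lt (hbet t ht).1) ((hbet t ht).2.trans_le (hg0 q hqI).2)
  have hfI : MeasureTheory.IntegrableOn f (Icc p q) := by
    rwa [integrableOn_Icc_iff_integrableOn_Ioc, ← intervalIntegrable_iff_integrableOn_Ioc_of_le hpq]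
  have h1 := intervalIntegral.sub_le_integral_of_hasDeriv_right_of_le ht₁.2 (hg.mono hsub)
    (fun t ht => (hD t ht).1.hasDerivWithinAt) (hfI.mono_set hsub) (fun t ht => (hD t ht).2)
  have h2 : ∫ t in t₁..t₂, f t ≤ ∫ t in p..q, f t := by
    refine intervalIntegral.integral_mono_interval ht₁.1 ht₁.2 ht₂.2 ?_ hf
    refine (MeasureTheory.ae_restrict_mem measurableSet_Ioc).mono fun t ht => ?_
    exact hf0 t (Ioc_subset_Icc_self ht)
  linarith

namespace FinslerMetric

variable {n : ℕ} {M : Type*} [TopologicalSpace M] [ChartedSpace (EuclideanSpace ℝ (Fin n)) M]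
  [IsManifold (𝓡 n) ∞ M] {F : FinslerMetric n M} {y : M} {η : ℝ}

theorem continuousOn_speed (F : FinslerMetric n M) {γ : ℝ → M} {p q : ℝ} (hpq : p < q)
    (hγ : ContMDiffOn 𝓘(ℝ, ℝ) (𝓡 n) 1 γ (Icc p q)) :
    ContinuousOn (fun t => F.toFun (velocity n γ p q t)) (Icc p q) := by
  have h1 : ContinuousOn (tangentMapWithin 𝓘(ℝ, ℝ) (𝓡 n) γ (Icc p q))
      (Bundle.TotalSpace.proj ⁻¹' Icc p q) :=
    hγ.continuousOn_tangentMapWithin le_rfl (uniqueDiffOn_Icc hpq).uniqueMDiffOn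
  have h2 : Continuous fun t : ℝ => (tangentBundleModelSpaceHomeomorph 𝓘(ℝ, ℝ)).symm (t, (1 : ℝ)) :=
    (tangentBundleModelSpaceHomeomorph 𝓘(ℝ, ℝ)).symm.continuous.comp
      (continuous_id.prodMk continuous_const)
  exact F.continuous_toFun.comp_continuousOn (h1.comp h2.continuousOn fun t ht => ht)

theorem velocity_eq_of_mem_Ioo {n : ℕ} {M : Type*} [TopologicalSpace M]
    [ChartedSpace (EuclideanSpace ℝ (Fin n)) M] {γ : ℝ → M} {a b p q t : ℝ} (hap : a ≤ p) (hqb : q ≤ b)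
    (ht : t ∈ Ioo p q) : velocity n γ a b t = velocity n γ p q t := by
  unfold velocity
  rw [mfderivWithin_of_mem_nhds (Icc_mem_nhds (hap.trans_lt ht.1) (ht.2.trans_le hqb)),
    mfderivWithin_of_mem_nhds (Icc_mem_nhds ht.1 ht.2)]

/-- A function which increases by at most the length along every `C¹` curve does so along every
piecewise `C¹` curve. -/
theorem sub_le_length_of_isPiecewiseC1 (F : FinslerMetric n M) {R : M → ℝ}
    (hR : ∀ (γ : ℝ → M) (p q : ℝ), p < q → ContMDiffOn 𝓘(ℝ, ℝ) (𝓡 n) 1 γ (Icc p q) →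
      R (γ q) - R (γ p) ≤ F.length γ p q) {γ : ℝ → M} {a b : ℝ} (hγ : IsPiecewiseC1 n γ a b) :
    R (γ b) - R (γ a) ≤ F.length γ a b := by
  obtain ⟨k, p, hp, rfl, rfl, hC⟩ := hγ
  have hstep : ∀ i < k, p i ≤ p (i + 1) := fun i _ => hp (Nat.le_succ i)
  have hlo : ∀ i, p 0 ≤ p i := fun i => hp (Nat.zero_le i)
  have hint : ∀ i < k, IntervalIntegrable (fun t => F.toFun (velocity n γ (p 0) (p k) t))
      MeasureTheory.volume (p i) (p (i + 1)) := by
    intro i hi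
    rcases (hstep i hi).eq_or_lt with heq | hlt
    · rw [heq]
    · refine IntervalIntegrable.congr_uIoo (f := fun t =>
        F.toFun (velocity n γ (p i) (p (i + 1)) t)) ?_ ?_
      rotate_left
      · rw [uIoo_of_le hlt.le]
        intro t ht
        simp only [velocity_eq_of_mem_Ioo (hlo i) (hp hi) ht]
      · refine ContinuousOn.intervalIntegrable ?_
        rw [uIcc_of_le hlt.le]
        exact F.continuousOn_speed hlt (hC i hi)
  unfold length
  -- Both the length and the increment of R split over the partition. Velocities on the whole
  -- interval and on a piece can differ only at break points, which do not affect the integrals.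
  rw [← intervalIntegral.sum_integral_adjacent_intervals hint,
    ← Finset.sum_range_sub (fun i => R (γ (p i))) k]
  refine Finset.sum_le_sum fun i hi => ?_
  rw [Finset.mem_range] at hi
  rcases (hstep i hi).eq_or_lt with heq | hlt
  · rw [heq]; simp
  · refine (hR γ _ _ hlt (hC i hi)).trans (le_of_eq ?_)
    refine intervalIntegral.integral_congr_Ioo_of_le hlt.le fun t ht => ?_
    simp only [velocity_eq_of_mem_Ioo (hlo i) (hp hi) ht]

/-- On a normal ball the truncated distance `min (F (exp_y⁻¹ z)) r` extends to a continuous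
function which increases by at most the length along every `C¹` curve. -/
theorem IsExpDiffeo.exists_truncated_distance [T2Space M] (h : F.IsExpDiffeo y η) (hη : 0 < η)
    {r : ℝ} (hr0 : 0 ≤ r) (hr : r < η) : ∃ R : M → ℝ,
      (∀ X ∈ F.tangentBall y η, R (F.expAt y X) = min (F.fiber y X) r) ∧
      ∀ (γ : ℝ → M) (p q : ℝ), p < q → ContMDiffOn 𝓘(ℝ, ℝ) (𝓡 n) 1 γ (Icc p q) →
        R (γ q) - R (γ p) ≤ F.length γ p q := by
  classical
  obtain ⟨L, hL, hL1, hLs⟩ := h.exists_inverse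
  obtain ⟨φ, hφ, hsrc, htgt, hφL, hsymm⟩ := h.exists_chart hη hL hLs
  let R : M → ℝ := fun z => if z ∈ F.expBall y η then min (F.fiber y (L z)) r else r
  have hRexp : ∀ X ∈ F.tangentBall y η, R (F.expAt y X) = min (F.fiber y X) r := by
    intro X hX
    simp only [R]
    rw [if_pos (show F.expAt y X ∈ F.expBall y η from mem_image_of_mem _ hX), hL hX]
  have hRle : ∀ z, R z ≤ r := by
    intro z
    simp only [R]
    split_ifs
    · exact min_le_right _ _
    · exact le_rfl
  have hR0 : ∀ z, 0 ≤ R z := by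
    intro z
    simp only [R]
    split_ifs
    · exact le_min (F.fiber_nonneg _ _) hr0
    · exact hr0
  -- The closed ball of radius r < η is compact, so its image is closed in M. Off that image R
  -- equals r, which gives continuity across the boundary of the normal ball.
  have hK : IsClosed (F.expAt y '' {X | F.fiber y X ≤ r}) :=
    ((F.isCompact_fiber_le y r).image_of_continuousOn
      (h.contMDiffOn_one.continuousOn.mono fun X hX => lt_of_le_of_lt hX hr)).isClosed
  have hRcont : Continuous R := by
    rw [continuous_iff_continuousAt]
    intro z
    by_cases hz : z ∈ F.expBall y η
    · have h1 : ContinuousAt L z := hL1.continuousOn.continuousAt (h.isOpen_expBall.mem_nhds hz)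
      have h2 : ContinuousAt (fun z => min (F.fiber y (L z)) r) z :=
        ((F.continuous_fiber y).continuousAt.comp h1).min continuousAt_const
      refine h2.congr ?_
      filter_upwards [h.isOpen_expBall.mem_nhds hz] with z' hz'
      simp only [R, if_pos hz']
    · have hzK : z ∉ F.expAt y '' {X | F.fiber y X ≤ r} := by
        rintro ⟨X, hX, rfl⟩
        exact hz (mem_image_of_mem _ (lt_of_le_of_lt hX hr))
      refine (continuousAt_const (y := r)).congr ?_
      filter_upwards [hK.isOpen_compl.mem_nhds hzK] with z' hz'
      simp only [R]
      split_ifs with hb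
      · obtain ⟨X, hX, rfl⟩ := hb
        rw [hL hX]
        refine (min_eq_right (le_of_lt ?_)).symm
        by_contra hc
        exact hz' (mem_image_of_mem _ (not_lt.1 hc))
      · rfl
  refine ⟨R, hRexp, fun γ p q hpq hγ => ?_⟩
  refine sub_le_integral_of_hasDerivAt_of_mem_Ioo (g := fun t => R (γ t))
    (g' := fun t => fderiv ℝ (F.fiber y) (φ (γ t)) (derivWithin (fun s => φ (γ s)) (Icc p q) t))
    (r := r) hpq.le (hRcont.comp_continuousOn hγ.continuousOn)
    (fun t _ => ⟨hR0 _, hRle _⟩) ?_ ?_ (fun t _ => F.nonneg _)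
  · intro t ht h0 hlt
    have htI := Ioo_subset_Icc_self ht
    have hnhds : Icc p q ∈ 𝓝 t := Icc_mem_nhds ht.1 ht.2
    -- A value of R strictly between 0 and r forces γ(t) into the punctured ball, the domain of the
    -- chart φ.
    have hz : γ t ∈ F.expBall y η := by
      by_contra hz
      simp only [R, if_neg hz, lt_irrefl] at hlt
    obtain ⟨X, hX, hXt⟩ := hz
    simp only [← hXt, hRexp X hX] at h0 hlt
    have hX0 : X ≠ 0 := by
      rintro rfl
      rw [fiber_zero] at h0
      exact lt_irrefl _ (h0.trans_le (min_le_left _ _))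
    have hXr : F.fiber y X < r := by
      rcases min_lt_iff.1 hlt with h | h
      · exact h
      · exact absurd h (lt_irrefl r)
    have hts : γ t ∈ φ.source := by
      rw [hsrc, ← hXt]
      exact mem_image_of_mem _ ⟨hX, hX0⟩
    have hφt : φ (γ t) = X := by rw [hφL, ← hXt, hL hX]
    have hc : MDifferentiableWithinAt 𝓘(ℝ, ℝ) (𝓡 n) γ (Icc p q) t :=
      (hγ t htI).mdifferentiableWithinAt (by simp)
    have hu := uniqueDiffOn_Icc hpq t htI
    have hd : HasDerivAt (fun s => φ (γ s)) (derivWithin (fun s => φ (γ s)) (Icc p q) t) t :=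
      (hasDerivWithinAt_chart_comp hφ hc hts).differentiableWithinAt.hasDerivWithinAt.hasDerivAt
        hnhds
    have hdiff : DifferentiableAt ℝ (F.fiber y) (φ (γ t)) := by
      rw [hφt]; exact F.differentiableAt_fiber y hX0
    have hcomp : HasDerivAt (fun s => F.fiber y (φ (γ s))) _ t :=
      HasFDerivAt.comp_hasDerivAt (l := F.fiber y) t hdiff.hasFDerivAt hd
    constructor
    · refine hcomp.congr_of_eventuallyEq ?_
      have hγt : ContinuousAt γ t := (hγ t htI).continuousWithinAt.continuousAt hnhds
      have hlt' : F.fiber y (φ (γ t)) < r := by rw [hφt]; exact hXr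
      -- The strict inequality ρ < r persists near t, so the truncation is inactive there.
      filter_upwards [hγt.eventually (φ.open_source.mem_nhds hts),
        hcomp.continuousAt.eventually (gt_mem_nhds hlt')] with s hs hsr
      rw [hφL] at hsr
      obtain ⟨Y, hY, hYs⟩ := hsrc ▸ hs
      rw [← hYs, hL hY.1] at hsr
      simp only [hφL, ← hYs, hRexp Y hY.1, hL hY.1]
      exact min_eq_left hsr.le
    · rw [← F.inChart_derivWithin hφ hc hu hts]
      exact h.fderiv_fiber_le hη hφ htgt hsymm (φ.map_source hts) _
  · refine ContinuousOn.intervalIntegrable ?_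
    rw [uIcc_of_le hpq.le]
    exact F.continuousOn_speed hpq hγ

/-- Short geodesics issuing from the centre of a normal ball minimize length. -/
theorem IsExpDiffeo.isLengthMinimizing [T2Space M] {c : ℝ → M} {a b : ℝ}
    (h : F.IsExpDiffeo (c a) η) (hab : a < b) (hc : F.IsGeodesic c a b)
    (hlen : F.length c a b < η) : F.IsLengthMinimizing c a b := by
  intro γ a' b' hγ ha hb
  -- X is the initial velocity of c rescaled to the interval [0,1], so that F(X) = L(c) and Exp X =
  -- c(b).
  set X : EuclideanSpace ℝ (Fin n) := (b - a) • curveDeriv n c (Icc a b) a with hX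
  have hFX : F.fiber (c a) X = F.length c a b := by
    rw [hX, F.fiber_smul _ _ (sub_nonneg.2 hab.le), hc.length_eq hab]
    rfl
  have hr0 : 0 ≤ F.length c a b := hFX ▸ F.fiber_nonneg _ _
  have hη : 0 < η := hr0.trans_lt hlen
  -- Truncation at r = L(c) < η leaves the value of R at c(b) equal to L(c).
  obtain ⟨R, hR, hRlen⟩ := h.exists_truncated_distance hη hr0 hlen
  have hcb : F.expAt (c a) X = c b := by
    rw [hX, hc.expAt_smul (sub_nonneg.2 hab.le) (by linarith)]
    congr 1
    ring
  have h1 := F.sub_le_length_of_isPiecewiseC1 hRlen hγ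
  have hRa : R (γ a') = 0 := by
    have := hR 0 (zero_mem_tangentBall hη)
    rw [F.expAt_zero, F.fiber_zero, min_eq_left hr0] at this
    rw [ha, this]
  have hRb : R (γ b') = F.length c a b := by
    have := hR X (by rw [mem_tangentBall, hFX]; exact hlen)
    rw [hcb, hFX, min_self] at this
    rw [hb, this]
  rw [hRa, hRb, sub_zero] at h1
  exact h1

end FinslerMetric

end Finsler

theorem proposition2p8 {n : ℕ} {M : Type*} [TopologicalSpace M] [T2Space M]
    [ChartedSpace (EuclideanSpace ℝ (Fin n)) M] [IsManifold (𝓡 n) ∞ M]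
    (F : Finsler.FinslerMetric n M) (x : M) (ε η : ℝ) (hεη : F.AreConvexRadii x ε η)
    (c : ℝ → M) (a b : ℝ) (hab : a < b) (hc : F.IsGeodesic c a b)
    (hy : c a ∈ F.expBall x ε) (hlen : F.length c a b < η) :
    F.IsLengthMinimizing c a b :=
  (hεη.diffeo_nearby (c a) hy).1.isLengthMinimizing hab hc hlen
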